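/- Fix a cutoff $\chi\in C^1(\mathbb R;\mathbb R)$ with $\operatorname{supp}\chi\subset[-2,2]$ and $\chi=1$ on $[-1,1]$, and put $\chi_R(x)=\chi(x/R)$ for $R>0$. Let $q_0\in\mathbb R$, and let $u_0\in q_0+H^2(\mathbb R)$ (complex-valued) satisfy $|u_0|^2-q_0^2\in L^1(\mathbb R)$. Let $J\ni 0$ be an open interval and let $u\in C(J,q_0+H^2(\mathbb R))$, differentiable in time with values in $q_0+L^2(\mathbb R)$ and with $\partial_t u\in C(J,L^2(\mathbb R))$, be a solution of $$ i\partial_t u+\partial_x^2u=-iu^2\,\partial_x\overline u,\qquad u(0)=u_0 $$ (for example the unique maximal solution in this class, with $J=(-T_{\min},T^{\max})$). Then for every $t\in J$ all the integrals below are absolutely convergent, for $u_0$ and for $u=u(t)$, the limits exist, and $$ M(u):=\lim_{R\to\infty}\int_{\mathbb R}(|u|^2-q_0^2)\chi_R\,dx=M(u_0), $$ $$ E(u):=\int_{\mathbb R}|\partial_xu|^2dx+\frac12\operatorname{Im}\int_{\mathbb R}(|u|^2\overline u-q_0^3)\,\partial_xu\,dx+\frac16\int_{\mathbb R}(|u|^2-|q_0|^2)^2(|u|^2+2|q_0|^2)\,dx=E(u_0),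 $$ $$ P(u):=\frac12\operatorname{Im}\int_{\mathbb R}(u-q_0)\,\partial_x\overline u\,dx-\int_{\mathbb R}\frac14(|u|^2-|q_0|^2)^2dx=P(u_0). $$ -/

import Mathlib

open MeasureTheory Filter Topology
open scoped ContDiff ComplexConjugate

noncomputable section

namespace DNLS

/-- The space `L²(ℝ)` of complex-valued functions, with Lebesgue measure. -/
abbrev L2 : Type := Lp ℂ 2 (volume : Measure ℝ)

/-- `g` is the weak (distributional) derivative of `f` on `ℝ`; both are locally integrable, and
test functions are the smooth compactly supported functions. -/
def HasWeakDeriv (f g : ℝ → ℂ) : Prop :=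
  LocallyIntegrable f ∧ LocallyIntegrable g ∧
    ∀ φ : ℝ → ℝ, ContDiff ℝ ∞ φ → HasCompactSupport φ →
      ∫ x, deriv φ x • f x = -∫ x, φ x • g x

/-- Weak derivatives are unique up to null sets. -/
theorem HasWeakDeriv.ae_unique {f g h : ℝ → ℂ} (hg : HasWeakDeriv f g) (hh : HasWeakDeriv f h) :
    g =ᵐ[volume] h := by
  refine ae_eq_of_integral_contDiff_smul_eq hg.2.1 hh.2.1 fun φ h1 h2 => ?_
  have e1 := hg.2.2 φ h1 h2
  have e2 := hh.2.2 φ h1 h2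
  exact neg_injective (e1.symm.trans e2)

open Classical in
/-- The weak derivative `∂f`, defined up to null sets (and `0` if there is none). -/
def weakDeriv (f : ℝ → ℂ) : ℝ → ℂ :=
  if h : ∃ g, HasWeakDeriv f g then h.choose else 0

theorem HasWeakDeriv.weakDeriv_ae_eq {f g : ℝ → ℂ} (h : HasWeakDeriv f g) :
    weakDeriv f =ᵐ[volume] g := by
  have hex : ∃ g, HasWeakDeriv f g := ⟨g, h⟩
  have hw : HasWeakDeriv f (weakDeriv f) := by
    unfold weakDeriv
    rw [dif_pos hex]
    exact hex.choose_spec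
  exact hw.ae_unique h

/-- `f ∈ H²(ℝ)`: the function and its first two weak derivatives are in `L²(ℝ)`. -/
def MemH2 (f : ℝ → ℂ) : Prop :=
  ∃ f₁ f₂ : ℝ → ℂ, HasWeakDeriv f f₁ ∧ HasWeakDeriv f₁ f₂ ∧
    MemLp f 2 ∧ MemLp f₁ 2 ∧ MemLp f₂ 2

/-- `w ∈ C(J, H²(ℝ))`: `w(t) ∈ H²(ℝ)` for `t ∈ J`, and `w`, `∂w`, `∂²w` are continuous from `J`
to `L²(ℝ)`, that is, `w` is continuous for the norm of `H²(ℝ)`. -/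
def ContinuousOnH2 (J : Set ℝ) (w : ℝ → ℝ → ℂ) : Prop :=
  ∃ W W₁ W₂ : ℝ → L2,
    ContinuousOn W J ∧ ContinuousOn W₁ J ∧ ContinuousOn W₂ J ∧
    ∀ t ∈ J, w t =ᵐ[volume] W t ∧ HasWeakDeriv (W t) (W₁ t) ∧ HasWeakDeriv (W₁ t) (W₂ t)

/-- `w` is differentiable on the open set `J` as a function of time with values in `L²(ℝ)`, and
its derivative is `v ∈ C(J, L²(ℝ))`. -/
def HasL2TimeDerivOn (J : Set ℝ) (w v : ℝ → ℝ → ℂ) : Prop :=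
  ∃ W V : ℝ → L2, ContinuousOn V J ∧
    ∀ t ∈ J, w t =ᵐ[volume] W t ∧ v t =ᵐ[volume] V t ∧ HasDerivAt W (V t) t

/-- `u ∈ C(J, q₀ + H²(ℝ))` is a solution on the open interval `J ∋ 0` of
`i ∂ₜu + ∂²u = -i u² ∂ū`, `u(0) = u₀`; it is differentiable as a function with values in
`q₀ + L²(ℝ)`, with `∂ₜu ∈ C(J, L²(ℝ))`, and the equation holds in `L²(ℝ)` at every time. -/
structure IsSolution (q₀ : ℝ) (u₀ : ℝ → ℂ) (J : Set ℝ) (u : ℝ → ℝ → ℂ) : Prop where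
  isOpen : IsOpen J
  ordConnected : J.OrdConnected
  zero_mem : (0 : ℝ) ∈ J
  continuousOn : ContinuousOnH2 J (fun t x => u t x - (q₀ : ℂ))
  equation : ∃ ut : ℝ → ℝ → ℂ, HasL2TimeDerivOn J (fun t x => u t x - (q₀ : ℂ)) ut ∧
    ∀ t ∈ J, ∀ᵐ x : ℝ,
      Complex.I * ut t x + weakDeriv (weakDeriv (u t)) x =
        -Complex.I * (u t x) ^ 2 * conj (weakDeriv (u t) x)
  initial : u 0 =ᵐ[volume] u₀

/-- The mass of `f` renormalized at `q₀` exists and equals `m`: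
`lim_{R → ∞} ∫ (|f|² - q₀²) χ(x / R) dx = m`. -/
def HasMass (q₀ : ℝ) (χ : ℝ → ℝ) (f : ℝ → ℂ) (m : ℝ) : Prop :=
  (∀ R : ℝ, 0 < R → Integrable (fun x : ℝ => (‖f x‖ ^ 2 - q₀ ^ 2) * χ (x / R))) ∧
    Tendsto (fun R : ℝ => ∫ x, (‖f x‖ ^ 2 - q₀ ^ 2) * χ (x / R)) atTop (𝓝 m)

/-- The energy of `f` renormalized at `q₀` exists (its three integrals converge absolutely) and
equals `e`. -/
def HasEnergy (q₀ : ℝ) (f : ℝ → ℂ) (e : ℝ) : Prop :=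
  Integrable (fun x => ‖weakDeriv f x‖ ^ 2) ∧
  Integrable (fun x => (((‖f x‖ ^ 2 : ℝ) : ℂ) * conj (f x) - (q₀ : ℂ) ^ 3) * weakDeriv f x) ∧
  Integrable (fun x => (‖f x‖ ^ 2 - |q₀| ^ 2) ^ 2 * (‖f x‖ ^ 2 + 2 * |q₀| ^ 2)) ∧
  e = (∫ x, ‖weakDeriv f x‖ ^ 2)
    + 1 / 2 * (∫ x, (((‖f x‖ ^ 2 : ℝ) : ℂ) * conj (f x) - (q₀ : ℂ) ^ 3) * weakDeriv f x).im
    + 1 / 6 * ∫ x, (‖f x‖ ^ 2 - |q₀| ^ 2) ^ 2 * (‖f x‖ ^ 2 + 2 * |q₀| ^ 2)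

/-- The momentum of `f` renormalized at `q₀` exists (its two integrals converge absolutely) and
equals `p`. -/
def HasMomentum (q₀ : ℝ) (f : ℝ → ℂ) (p : ℝ) : Prop :=
  Integrable (fun x => (f x - (q₀ : ℂ)) * conj (weakDeriv f x)) ∧
  Integrable (fun x => 1 / 4 * (‖f x‖ ^ 2 - |q₀| ^ 2) ^ 2) ∧
  p = 1 / 2 * (∫ x, (f x - (q₀ : ℂ)) * conj (weakDeriv f x)).im
    - ∫ x, 1 / 4 * (‖f x‖ ^ 2 - |q₀| ^ 2) ^ 2

end DNLS

end

/-! Write u = q₀ + w. The formal proof differentiates each functional in time and recognises a total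
x-derivative. At H² regularity this needs care: w is differentiable in time only with values in L²,
so ∂ₓw has no time derivative in L², and u has no third space derivative in L².

The first difficulty is met by working with finite increments. For two states a, b, the real part of
the difference of densities is exactly (∂b - ∂a) X + (b - a) Y, with X in H¹ and Y in L²
(`energyDensity_sub_re`, `momentumDensity_sub_re`). Integration by parts turns this into Re ∫ (b -
a)(Y - ∂X). Dividing by the time increment, the first factor converges in L² to ∂ₜw and the second
is continuous in L², so the functional is differentiable (`hasDerivAt_of_sub_eq_re_integral`).

The second difficulty disappears because i|∂²w|² has no real part. What remains of Re ∂ₜw (Y - ∂X)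
is, by polynomial identities (`energy_flux_re`, `momentum_flux_re`), the real part of a sum of
derivatives of products of two H¹ functions, whose integrals vanish. Hence E and P have zero
derivative on J.

For the mass, |u|² - q₀² is integrable at time 0 by hypothesis, but at later times only L² control
is available; this is why a cutoff is used. The truncated mass changes at rate -Re ∫ ∂χ_R · flux,
with flux bounded in L² on compact time intervals and ‖∂χ_R‖₂ = R^(-1/2) ‖χ'‖₂. The change between
two times therefore tends to 0 (`tendsto_mass_sub`), and the limit at time 0 passes to every time.
-/

noncomputable section

namespace DNLS

open scoped ENNReal

/-! ### Locally absolutely continuous functions. -/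

theorem intervalIntegrable_of_locallyIntegrable {f : ℝ → ℂ} (hf : LocallyIntegrable f) (a b : ℝ) :
    IntervalIntegrable f volume a b :=
  intervalIntegrable_iff.mpr
    ((hf.integrableOn_isCompact isCompact_uIcc).mono_set Set.uIoc_subset_uIcc)

theorem absolutelyContinuousOnInterval_const (c : ℂ) (a b : ℝ) :
    AbsolutelyContinuousOnInterval (fun _ : ℝ => c) a b :=
  (contDiff_const (n := 1)).contDiffOn.absolutelyContinuousOnInterval

theorem absolutelyContinuousOnInterval_ofReal {r : ℝ → ℝ} {a b : ℝ}
    (h : AbsolutelyContinuousOnInterval r a b) :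
    AbsolutelyContinuousOnInterval (fun x => (r x : ℂ)) a b := by
  have e : (fun x => (r x : ℂ)) = r • fun _ => (1 : ℂ) := by
    funext x
    simp
  rw [e]
  exact h.smul (absolutelyContinuousOnInterval_const 1 a b)

/-- Real and imaginary parts reduce this to real-valued integrands. -/
theorem absolutelyContinuousOnInterval_integral {f : ℝ → ℂ} {a b : ℝ}
    (hf : IntervalIntegrable f volume a b) :
    AbsolutelyContinuousOnInterval (fun x => ∫ y in a..x, f y) a b := by
  have hre : IntervalIntegrable (fun x => (f x).re) volume a b := ⟨hf.1.re, hf.2.re⟩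
  have him : IntervalIntegrable (fun x => (f x).im) volume a b := ⟨hf.1.im, hf.2.im⟩
  have h1 := absolutelyContinuousOnInterval_ofReal
    (hre.absolutelyContinuousOnInterval_intervalIntegral (c := a) (by simp))
  have h2 := (absolutelyContinuousOnInterval_ofReal
    (him.absolutelyContinuousOnInterval_intervalIntegral (c := a) (by simp))).const_smul Complex.I
  have h3 := h1.add h2
  have key : Set.EqOn (fun x => ∫ y in a..x, f y)
      ((fun x => ((∫ y in a..x, (f y).re : ℝ) : ℂ)) +
        fun x => Complex.I • ((∫ y in a..x, (f y).im : ℝ) : ℂ)) (Set.uIcc a b) := by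
    intro x hx
    have hfx : IntervalIntegrable f volume a x :=
      hf.mono_set (Set.uIcc_subset_uIcc_left hx)
    have hrx : IntervalIntegrable (fun x => (f x).re) volume a x := ⟨hfx.1.re, hfx.2.re⟩
    have hix : IntervalIntegrable (fun x => (f x).im) volume a x := ⟨hfx.1.im, hfx.2.im⟩
    have e1 := intervalIntegral.integral_add (f := fun y => (((f y).re : ℝ) : ℂ))
      (g := fun y => Complex.I * (((f y).im : ℝ) : ℂ)) (a := a) (b := x) (μ := volume)
      ⟨hrx.1.ofReal, hrx.2.ofReal⟩ ⟨hix.1.ofReal.const_mul _, hix.2.ofReal.const_mul _⟩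
    change _ = ((∫ y in a..x, (f y).re : ℝ) : ℂ) + Complex.I * ((∫ y in a..x, (f y).im : ℝ) : ℂ)
    rw [← intervalIntegral.integral_ofReal, ← intervalIntegral.integral_ofReal]
    rw [intervalIntegral.integral_const_mul] at e1
    rw [← e1]
    refine intervalIntegral.integral_congr fun y _ => ?_
    change f y = ((f y).re : ℂ) + Complex.I * ((f y).im : ℂ)
    rw [mul_comm, Complex.re_add_im]
  rw [absolutelyContinuousOnInterval_iff] at h3 ⊢
  intro ε hε
  obtain ⟨δ, hδ, H⟩ := h3 ε hε
  refine ⟨δ, hδ, fun E hE hE' => ?_⟩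
  have := H E hE hE'
  refine lt_of_eq_of_lt (Finset.sum_congr rfl fun i hi => ?_) this
  exact congrArg₂ dist (key (hE.1 i hi).1) (key (hE.1 i hi).2)

/-- `F` is locally absolutely continuous on `ℝ`, with locally integrable derivative `f`. -/
structure HasACDeriv (F f : ℝ → ℂ) : Prop where
  intervalIntegrable : ∀ a b : ℝ, IntervalIntegrable f volume a b
  absolutelyContinuous : ∀ a b : ℝ, AbsolutelyContinuousOnInterval F a b
  hasDerivAt : ∀ᵐ x, HasDerivAt F (f x) x

namespace HasACDeriv

variable {F G f g : ℝ → ℂ}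

theorem continuous (h : HasACDeriv F f) : Continuous F := by
  rw [continuous_iff_continuousAt]
  intro x
  refine (h.absolutelyContinuous (x - 1) (x + 1)).continuousOn.continuousAt ?_
  rw [Set.uIcc_of_le (by linarith)]
  exact Icc_mem_nhds (by linarith) (by linarith)

theorem congr_ae (h : HasACDeriv F f) (hfg : f =ᵐ[volume] g) : HasACDeriv F g where
  intervalIntegrable a b := (h.intervalIntegrable a b).congr_ae (ae_restrict_of_ae hfg)
  absolutelyContinuous := h.absolutelyContinuous
  hasDerivAt := by
    filter_upwards [h.hasDerivAt, hfg] with x hx e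
    rwa [← e]

theorem of_contDiff (h : ContDiff ℝ 1 F) : HasACDeriv F (deriv F) where
  intervalIntegrable a b := (h.continuous_deriv le_rfl).intervalIntegrable a b
  absolutelyContinuous _ _ := h.contDiffOn.absolutelyContinuousOnInterval
  hasDerivAt := ae_of_all _ fun x => (h.differentiable one_ne_zero x).hasDerivAt

theorem const (c : ℂ) : HasACDeriv (fun _ => c) (fun _ => 0) := by
  have := of_contDiff (F := fun _ : ℝ => c) contDiff_const
  simpa using this

theorem add (hF : HasACDeriv F f) (hG : HasACDeriv G g) :
    HasACDeriv (fun x => F x + G x) (fun x => f x + g x) where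
  intervalIntegrable a b := (hF.intervalIntegrable a b).add (hG.intervalIntegrable a b)
  absolutelyContinuous a b := (hF.absolutelyContinuous a b).add (hG.absolutelyContinuous a b)
  hasDerivAt := by
    filter_upwards [hF.hasDerivAt, hG.hasDerivAt] with x h1 h2 using h1.add h2

theorem sub (hF : HasACDeriv F f) (hG : HasACDeriv G g) :
    HasACDeriv (fun x => F x - G x) (fun x => f x - g x) where
  intervalIntegrable a b := (hF.intervalIntegrable a b).sub (hG.intervalIntegrable a b)
  absolutelyContinuous a b := (hF.absolutelyContinuous a b).sub (hG.absolutelyContinuous a b)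
  hasDerivAt := by
    filter_upwards [hF.hasDerivAt, hG.hasDerivAt] with x h1 h2 using h1.sub h2

theorem mul (hF : HasACDeriv F f) (hG : HasACDeriv G g) :
    HasACDeriv (fun x => F x * G x) (fun x => f x * G x + F x * g x) where
  intervalIntegrable a b :=
    ((hF.intervalIntegrable a b).mul_continuousOn hG.continuous.continuousOn).add
      ((hG.intervalIntegrable a b).continuousOn_mul hF.continuous.continuousOn)
  absolutelyContinuous a b := (hF.absolutelyContinuous a b).smul (hG.absolutelyContinuous a b)
  hasDerivAt := by
    filter_upwards [hF.hasDerivAt, hG.hasDerivAt] with x h1 h2 using h1.mul h2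

theorem const_mul (c : ℂ) (hF : HasACDeriv F f) :
    HasACDeriv (fun x => c * F x) (fun x => c * f x) := by
  simpa using (const c).mul hF

theorem add_const (hF : HasACDeriv F f) (c : ℂ) : HasACDeriv (fun x => F x + c) f := by
  simpa using hF.add (const c)

theorem star (hF : HasACDeriv F f) :
    HasACDeriv (fun x => conj (F x)) (fun x => conj (f x)) where
  intervalIntegrable a b :=
    ⟨(Complex.conjLIE.integrable_comp_iff).2 (hF.intervalIntegrable a b).1,
      (Complex.conjLIE.integrable_comp_iff).2 (hF.intervalIntegrable a b).2⟩
  absolutelyContinuous a b := by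
    have := hF.absolutelyContinuous a b
    rw [absolutelyContinuousOnInterval_iff] at this ⊢
    simpa only [Complex.dist_conj_conj] using this
  hasDerivAt := by
    filter_upwards [hF.hasDerivAt] with x h1
    exact h1.star

/-- F minus the primitive of f is absolutely continuous with derivative zero almost everywhere,
hence constant on the interval. -/
theorem integral_eq_sub (hF : HasACDeriv F f) (a b : ℝ) : ∫ x in a..b, f x = F b - F a := by
  have hi := hF.intervalIntegrable a b
  have h1 := (hF.absolutelyContinuous a b).sub (absolutelyContinuousOnInterval_integral hi)
  obtain ⟨C, hC⟩ := h1.const_of_ae_hasDerivAt_zero (by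
    filter_upwards [hF.hasDerivAt, hi.ae_hasDerivAt_integral] with x hx hx' hmem
    have := hx.sub (hx' hmem a (by simp))
    rwa [sub_self] at this)
  have ha := hC a (by simp)
  have hb := hC b (by simp)
  simp only [Pi.sub_apply, intervalIntegral.integral_same, sub_zero] at ha hb
  rw [ha, ← hb]
  ring

theorem of_locallyIntegrable (hf : LocallyIntegrable f) :
    HasACDeriv (fun x => ∫ y in (0:ℝ)..x, f y) f where
  intervalIntegrable := intervalIntegrable_of_locallyIntegrable hf
  absolutelyContinuous a b := by
    have h := absolutelyContinuousOnInterval_integral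
      (intervalIntegrable_of_locallyIntegrable hf a b)
    have e : (fun x => ∫ y in (0:ℝ)..x, f y) =
        (fun x => ∫ y in a..x, f y) + fun _ => ∫ y in (0:ℝ)..a, f y := by
      funext x
      rw [Pi.add_apply, add_comm, intervalIntegral.integral_add_adjacent_intervals] <;>
      exact intervalIntegrable_of_locallyIntegrable hf _ _
    rw [e]
    exact h.add (absolutelyContinuousOnInterval_const (∫ y in (0:ℝ)..a, f y) a b)
  hasDerivAt := by
    filter_upwards [_root_.LocallyIntegrable.ae_hasDerivAt_integral hf] with x hx using hx 0

/-- Integrability of f gives F limits at both ends of the line, and integrability of F forces these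
limits to be 0. All integrations by parts on ℝ rest on this. -/
theorem integral_eq_zero (hF : HasACDeriv F f) (hFi : Integrable F) (hfi : Integrable f) :
    ∫ x, f x = 0 := by
  -- A nonzero limit would keep ‖F‖ above a positive constant on a half-line, a set of infinite
  -- measure.
  have key : ∀ l : Filter ℝ, ∀ c : ℂ, Tendsto F l (𝓝 c) → (l = atTop ∨ l = atBot) → c = 0 := by
    intro l c hl hl'
    have h := hFi.norm
    have h2 : Tendsto (fun x => ‖F x‖) l (𝓝 ‖c‖) := hl.norm
    by_contra hc
    have hpos : 0 < ‖c‖ / 2 := by positivity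
    have hev : ∀ᶠ x in l, ‖c‖ / 2 ≤ ‖F x‖ :=
      (h2.eventually (lt_mem_nhds (half_lt_self (by positivity)))).mono fun x hx => hx.le
    have hfin := h.measure_ge_lt_top hpos
    rcases hl' with rfl | rfl
    · obtain ⟨R, hR⟩ := eventually_atTop.1 hev
      have : volume (Set.Ici R) ≤ volume {x | ‖c‖ / 2 ≤ ‖F x‖} :=
        measure_mono fun x hx => hR x hx
      simp at this
      exact hfin.ne this
    · obtain ⟨R, hR⟩ := eventually_atBot.1 hev
      have : volume (Set.Iic R) ≤ volume {x | ‖c‖ / 2 ≤ ‖F x‖} :=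
        measure_mono fun x hx => hR x hx
      simp at this
      exact hfin.ne this
  have hT : Tendsto F atTop (𝓝 (F 0 + ∫ x in Set.Ioi 0, f x)) := by
    have := (intervalIntegral_tendsto_integral_Ioi 0 hfi.integrableOn tendsto_id).const_add (F 0)
    refine this.congr fun x => ?_
    simp [hF.integral_eq_sub]
  have hB : Tendsto F atBot (𝓝 (F 0 - ∫ x in Set.Iic 0, f x)) := by
    have := (intervalIntegral_tendsto_integral_Iic 0 hfi.integrableOn tendsto_id).const_sub (F 0)
    refine this.congr fun x => ?_
    simp [hF.integral_eq_sub]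
  have e1 := key _ _ hT (Or.inl rfl)
  have e2 := key _ _ hB (Or.inr rfl)
  rw [← intervalIntegral.integral_Iic_add_Ioi (b := 0) hfi.integrableOn hfi.integrableOn]
  linear_combination e1 - e2

end HasACDeriv

/-! ### The Sobolev embedding of H¹ in L^∞. -/

theorem integral_norm_le_eLpNorm_two {f : ℝ → ℂ} (hf : MemLp f 2) (x : ℝ) :
    ∫ y in x..x + 1, ‖f y‖ ≤ (eLpNorm f 2).toReal := by
  rw [intervalIntegral.integral_of_le (by linarith)]
  have hm : AEStronglyMeasurable f (volume.restrict (Set.Ioc x (x + 1))) := hf.1.restrict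
  rw [integral_norm_eq_lintegral_enorm hm, ← eLpNorm_one_eq_lintegral_enorm]
  refine ENNReal.toReal_mono hf.2.ne ?_
  have h1 : eLpNorm f 1 (volume.restrict (Set.Ioc x (x + 1))) ≤
      eLpNorm f 2 (volume.restrict (Set.Ioc x (x + 1))) := by
    have := eLpNorm_le_eLpNorm_mul_rpow_measure_univ (p := 1) (q := 2) (by norm_num) hm
    simpa using this
  exact h1.trans (eLpNorm_mono_measure _ Measure.restrict_le_self)

/-- Average ‖F x‖ ≤ ‖F y‖ + ∫ ‖f‖ over y in [x, x + 1]. On an interval of length one the L¹ norm is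
at most the L² norm, so no constant appears. -/
theorem HasACDeriv.norm_le {F f : ℝ → ℂ} (h : HasACDeriv F f) (hF : MemLp F 2) (hf : MemLp f 2)
    (x : ℝ) : ‖F x‖ ≤ (eLpNorm F 2).toReal + (eLpNorm f 2).toReal := by
  have hx : x ≤ x + 1 := by linarith
  have key : ∀ y ∈ Set.Icc x (x + 1), ‖F x‖ ≤ ‖F y‖ + ∫ z in x..x + 1, ‖f z‖ := by
    intro y hy
    have e : F x = F y - ∫ z in x..y, f z := by rw [h.integral_eq_sub]; ring
    have h1 : ‖∫ z in x..y, f z‖ ≤ ∫ z in x..y, ‖f z‖ :=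
      intervalIntegral.norm_integral_le_integral_norm hy.1
    have h2 : ∫ z in x..y, ‖f z‖ ≤ ∫ z in x..x + 1, ‖f z‖ :=
      intervalIntegral.integral_mono_interval le_rfl hy.1 hy.2
        (ae_of_all _ fun _ => norm_nonneg _) (h.intervalIntegrable _ _).norm
    calc ‖F x‖ ≤ ‖F y‖ + ‖∫ z in x..y, f z‖ := by rw [e]; exact norm_sub_le _ _
      _ ≤ _ := by linarith
  have hc : IntervalIntegrable (fun y => ‖F y‖) volume x (x + 1) :=
    h.continuous.norm.intervalIntegrable _ _
  have h3 : ∫ _ in x..x + 1, ‖F x‖ ≤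
      ∫ y in x..x + 1, (‖F y‖ + ∫ z in x..x + 1, ‖f z‖) :=
    intervalIntegral.integral_mono_on hx (by simp) (hc.add (by simp)) key
  rw [intervalIntegral.integral_add hc (by simp)] at h3
  simp only [intervalIntegral.integral_const, add_sub_cancel_left, one_smul] at h3
  linarith [integral_norm_le_eLpNorm_two hF x, integral_norm_le_eLpNorm_two hf x]

/-! ### Weak derivatives and absolutely continuous representatives. -/

/-- A compactly supported `C¹` function integrates by parts against absolutely continuous ones. -/
theorem HasACDeriv.integral_deriv_smul {F f : ℝ → ℂ} (h : HasACDeriv F f)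
    (hf : LocallyIntegrable f) {φ : ℝ → ℝ} (hφ : ContDiff ℝ 1 φ) (hc : HasCompactSupport φ) :
    ∫ x, deriv φ x • F x = -∫ x, φ x • f x := by
  have hF : LocallyIntegrable F := h.continuous.locallyIntegrable
  have hφ' := hφ.continuous_deriv le_rfl
  have i1 : Integrable (fun x => deriv φ x • F x) :=
    hF.integrable_smul_left_of_hasCompactSupport hφ' hc.deriv
  have i2 : Integrable (fun x => φ x • f x) :=
    hf.integrable_smul_left_of_hasCompactSupport hφ.continuous hc
  have i3 : Integrable (fun x => φ x • F x) :=
    hF.integrable_smul_left_of_hasCompactSupport hφ.continuous hc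
  have hφC : HasACDeriv (fun x => (φ x : ℂ)) (fun x => ((deriv φ x : ℝ) : ℂ)) := by
    have := HasACDeriv.of_contDiff (F := fun x => (φ x : ℂ))
      (Complex.ofRealCLM.contDiff.comp hφ)
    convert this using 1
    ext x
    exact (((hφ.differentiable one_ne_zero x).hasDerivAt).ofReal_comp).deriv.symm
  have := (hφC.mul h).integral_eq_zero (by simpa using i3) (by simpa using! i1.add i2)
  have e := integral_add i1 i2
  simp only [Complex.real_smul] at e ⊢
  rw [e] at this
  exact eq_neg_of_add_eq_zero_left this

/-- A locally integrable function with vanishing weak derivative is constant. -/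
theorem ae_eq_const_of_hasWeakDeriv_zero {f : ℝ → ℂ} (hf : LocallyIntegrable f)
    (h : ∀ φ : ℝ → ℝ, ContDiff ℝ ∞ φ → HasCompactSupport φ → ∫ x, deriv φ x • f x = 0) :
    ∃ c : ℂ, f =ᵐ[volume] fun _ => c := by
  let ψ : ContDiffBump (0 : ℝ) := ⟨1, 2, one_pos, one_lt_two⟩
  have hψ : ContDiff ℝ ∞ (ψ.normed volume) := ψ.contDiff_normed
  have hψc : HasCompactSupport (ψ.normed volume) := ψ.hasCompactSupport_normed
  have hψ1 : ∫ x, ψ.normed volume x = 1 := ψ.integral_normed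
  refine ⟨∫ x, ψ.normed volume x • f x, ?_⟩
  refine ae_eq_of_integral_contDiff_smul_eq hf (locallyIntegrable_const _) fun η hη hηc => ?_
  set m : ℝ := ∫ x, η x with hm
  -- Subtracting the right multiple of a fixed bump gives η zero integral, and a test function of
  -- zero integral is the derivative of a test function. The constant is thus the mean of f against
  -- the bump.
  set θ : ℝ → ℝ := fun x => η x - m * ψ.normed volume x with hθ
  have hθs : ContDiff ℝ ∞ θ := hη.sub (contDiff_const.mul hψ)
  have iη : Integrable η := hη.continuous.integrable_of_hasCompactSupport hηc
  have iψ : Integrable (ψ.normed volume) := hψ.continuous.integrable_of_hasCompactSupport hψc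
  have hθc : HasCompactSupport θ := hηc.sub (hψc.mul_left)
  have hθ0 : ∫ x, θ x = 0 := by
    simp only [hθ]
    rw [integral_sub iη (iψ.const_mul _), integral_const_mul, hψ1, ← hm]
    ring
  obtain ⟨R, hR⟩ : ∃ R : ℝ, ∀ x, R ≤ |x| → θ x = 0 := by
    obtain ⟨R, hR⟩ := hθc.isCompact.isBounded.subset_closedBall 0
    refine ⟨R + 1, fun x hx => image_eq_zero_of_notMem_tsupport fun hx' => ?_⟩
    have := hR hx'
    rw [Metric.mem_closedBall, dist_zero_right, Real.norm_eq_abs] at this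
    linarith
  -- θ vanishes outside [-|R|, |R|], so Φ vanishes to the left of it, and to the right because θ has
  -- integral 0.
  let Φ : ℝ → ℝ := fun x => ∫ y in (-|R|)..x, θ y
  have hd : ∀ x, HasDerivAt Φ (θ x) x := fun x =>
    intervalIntegral.integral_hasDerivAt_right (hθs.continuous.intervalIntegrable _ _)
      (hθs.continuous.stronglyMeasurableAtFilter _ _) hθs.continuous.continuousAt
  have hderiv : deriv Φ = θ := funext fun x => (hd x).deriv
  have hΦ : ContDiff ℝ ∞ Φ := by
    rw [contDiff_infty_iff_deriv, hderiv]
    exact ⟨fun x => (hd x).differentiableAt, hθs⟩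
  have hΦc : HasCompactSupport Φ := by
    refine HasCompactSupport.of_support_subset_isCompact (isCompact_Icc (a := -|R|) (b := |R|)) ?_
    intro x hx
    by_contra hx'
    apply hx
    rw [Set.mem_Icc, not_and_or, not_le, not_le] at hx'
    rcases hx' with hx' | hx'
    · have : Set.EqOn θ (fun _ => 0) (Set.uIcc (-|R|) x) := by
        intro y hy
        rw [Set.uIcc_of_ge hx'.le] at hy
        exact hR y (by linarith [hy.2, neg_abs_le y, le_abs_self R, neg_le_abs y])
      simp only [Φ]
      rw [intervalIntegral.integral_congr this]
      simp
    · have e := intervalIntegral.integral_eq_integral_of_support_subset (f := θ) (μ := volume)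
        (a := -|R|) (b := x) (by
        intro y hy
        by_contra hy'
        apply hy
        rw [Set.mem_Ioc, not_and_or, not_lt, not_le] at hy'
        rcases hy' with hy' | hy'
        · exact hR y (by linarith [le_abs_self R, neg_le_abs y])
        · exact hR y (by linarith [le_abs_self R, le_abs_self y]))
      simp only [Φ]
      rw [e, hθ0]
  have key := h Φ hΦ hΦc
  rw [hderiv] at key
  have i1 : Integrable (fun x => η x • f x) :=
    hf.integrable_smul_left_of_hasCompactSupport hη.continuous hηc
  have i2 : Integrable (fun x => ψ.normed volume x • f x) :=
    hf.integrable_smul_left_of_hasCompactSupport hψ.continuous hψc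
  have e3 : ∫ x, θ x • f x =
      (∫ x, η x • f x) - m • ∫ x, ψ.normed volume x • f x := by
    have i4 : Integrable (fun x => m • ψ.normed volume x • f x) := i2.smul m
    rw [← integral_smul, ← integral_sub i1 i4]
    refine integral_congr_ae (ae_of_all _ fun x => ?_)
    simp only [hθ, sub_smul, mul_smul]
  rw [e3, sub_eq_zero] at key
  rw [key, integral_smul_const]

/-- A function with a weak derivative has a locally absolutely continuous representative. -/
theorem HasWeakDeriv.exists_hasACDeriv {f g : ℝ → ℂ} (h : HasWeakDeriv f g) :
    ∃ F : ℝ → ℂ, f =ᵐ[volume] F ∧ HasACDeriv F g := by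
  have hG := HasACDeriv.of_locallyIntegrable h.2.1
  have hGl : LocallyIntegrable (fun x => ∫ y in (0:ℝ)..x, g y) := hG.continuous.locallyIntegrable
  obtain ⟨c, hc⟩ := ae_eq_const_of_hasWeakDeriv_zero (h.1.sub hGl) (by
    intro φ hφ hφc
    have hφ1 : ContDiff ℝ 1 φ := hφ.of_le (by exact_mod_cast le_top)
    have e1 := h.2.2 φ hφ hφc
    have e2 := hG.integral_deriv_smul h.2.1 hφ1 hφc
    have hφ' := hφ1.continuous_deriv le_rfl
    simp only [Pi.sub_apply, smul_sub]
    rw [integral_sub (h.1.integrable_smul_left_of_hasCompactSupport hφ' hφc.deriv)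
      (hGl.integrable_smul_left_of_hasCompactSupport hφ' hφc.deriv), e1, e2, sub_self])
  refine ⟨fun x => (∫ y in (0:ℝ)..x, g y) + c, ?_, hG.add_const c⟩
  filter_upwards [hc] with x hx
  simp only [Pi.sub_apply] at hx
  rw [← hx]
  ring

theorem HasACDeriv.hasWeakDeriv {F f : ℝ → ℂ} (h : HasACDeriv F f) (hf : LocallyIntegrable f) :
    HasWeakDeriv F f :=
  ⟨h.continuous.locallyIntegrable, hf, fun _ hφ hφc =>
    h.integral_deriv_smul hf (hφ.of_le (by exact_mod_cast le_top)) hφc⟩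

/-! ### Convergence in Lᵖ and Hölder products. -/

theorem memLp_conj {p : ℝ≥0∞} {f : ℝ → ℂ} (hf : MemLp f p) : MemLp (fun x => conj (f x)) p :=
  hf.star

/-- The functions `f s` converge to `g` in `Lᵖ(ℝ)` along `l`. -/
structure TendstoLp (p : ℝ≥0∞) (l : Filter ℝ) (f : ℝ → ℝ → ℂ) (g : ℝ → ℂ) : Prop where
  memLp : ∀ s, MemLp (f s) p
  memLp_lim : MemLp g p
  tendsto : Tendsto (fun s => eLpNorm (fun x => f s x - g x) p volume) l (𝓝 0)

namespace TendstoLp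

variable {p : ℝ≥0∞} {l : Filter ℝ} {f f' : ℝ → ℝ → ℂ} {g g' : ℝ → ℂ}

theorem mono (h : TendstoLp p l f g) {l' : Filter ℝ} (hl : l' ≤ l) : TendstoLp p l' f g :=
  ⟨h.memLp, h.memLp_lim, h.tendsto.mono_left hl⟩

theorem congr (h : TendstoLp p l f g) (hf : ∀ s x, f s x = f' s x) (hg : ∀ x, g x = g' x) :
    TendstoLp p l f' g' := by
  obtain rfl : f = f' := funext fun s => funext fun x => hf s x
  obtain rfl : g = g' := funext hg
  exact h

theorem const (hg : MemLp g p) : TendstoLp p l (fun _ => g) g :=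
  ⟨fun _ => hg, hg, by simpa using tendsto_const_nhds⟩

theorem add [hp : Fact (1 ≤ p)] (h : TendstoLp p l f g) (h' : TendstoLp p l f' g') :
    TendstoLp p l (fun s x => f s x + f' s x) (fun x => g x + g' x) := by
  refine ⟨fun s => (h.memLp s).add (h'.memLp s), h.memLp_lim.add h'.memLp_lim, ?_⟩
  have := h.tendsto.add h'.tendsto
  rw [add_zero] at this
  refine tendsto_of_tendsto_of_tendsto_of_le_of_le tendsto_const_nhds this
    (fun _ => zero_le) fun s => ?_
  have := eLpNorm_add_le ((h.memLp s).sub h.memLp_lim).1 ((h'.memLp s).sub h'.memLp_lim).1 hp.out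
  refine le_of_eq_of_le (congrArg (fun k => eLpNorm k p volume) ?_) this
  funext x
  simp only [Pi.add_apply, Pi.sub_apply]
  ring

theorem const_mul (c : ℂ) (h : TendstoLp p l f g) :
    TendstoLp p l (fun s x => c * f s x) (fun x => c * g x) := by
  refine ⟨fun s => (h.memLp s).const_mul c, h.memLp_lim.const_mul c, ?_⟩
  have := ENNReal.Tendsto.const_mul (a := ‖c‖ₑ) h.tendsto (Or.inr enorm_ne_top)
  rw [mul_zero] at this
  refine this.congr fun s => ?_
  rw [← eLpNorm_const_smul]
  refine congrArg (fun k => eLpNorm k p volume) (funext fun x => ?_)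
  simp only [Pi.smul_apply, smul_eq_mul]
  ring

theorem sub [hp : Fact (1 ≤ p)] (h : TendstoLp p l f g) (h' : TendstoLp p l f' g') :
    TendstoLp p l (fun s x => f s x - f' s x) (fun x => g x - g' x) :=
  (h.add (h'.const_mul (-1))).congr (fun _ _ => by ring) fun _ => by ring

theorem star (h : TendstoLp p l f g) :
    TendstoLp p l (fun s x => conj (f s x)) (fun x => conj (g x)) := by
  refine ⟨fun s => memLp_conj (h.memLp s), memLp_conj h.memLp_lim, h.tendsto.congr fun s => ?_⟩
  refine eLpNorm_congr_norm_ae (ae_of_all _ fun x => ?_)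
  rw [← map_sub, RCLike.norm_conj]

theorem mul {q r : ℝ≥0∞} [hr : Fact (1 ≤ r)] [ENNReal.HolderTriple p q r]
    (h : TendstoLp p l f g) (h' : TendstoLp q l f' g') :
    TendstoLp r l (fun s x => f s x * f' s x) (fun x => g x * g' x) := by
  refine ⟨fun s => (h'.memLp s).mul' (h.memLp s), h'.memLp_lim.mul' h.memLp_lim, ?_⟩
  have hF : ∀ s, AEStronglyMeasurable (fun x => f s x - g x) volume :=
    fun s => ((h.memLp s).sub h.memLp_lim).1
  have hF' : ∀ s, AEStronglyMeasurable (fun x => f' s x - g' x) volume :=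
    fun s => ((h'.memLp s).sub h'.memLp_lim).1
  have t1 := ENNReal.Tendsto.mul h.tendsto (Or.inr (by simp)) h'.tendsto (Or.inr (by simp))
  have t2 := ENNReal.Tendsto.mul_const (b := eLpNorm g' q volume) h.tendsto
    (Or.inr h'.memLp_lim.2.ne)
  have t3 := ENNReal.Tendsto.const_mul (a := eLpNorm g p volume) h'.tendsto
    (Or.inr h.memLp_lim.2.ne)
  have t := (t1.add t2).add t3
  simp only [mul_zero, zero_mul, add_zero] at t
  refine tendsto_of_tendsto_of_tendsto_of_le_of_le tendsto_const_nhds t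
    (fun _ => zero_le) fun s => ?_
  -- Expanding around the limits leaves only increments and the fixed limits, so no uniform bound on
  -- the norms of `f s` and `f' s` is needed.
  have e : (fun x => f s x * f' s x - g x * g' x) =
      ((fun x => f s x - g x) • (fun x => f' s x - g' x) + (fun x => f s x - g x) • g') +
        g • (fun x => f' s x - g' x) := by
    funext x
    simp only [Pi.add_apply, Pi.mul_apply, smul_eq_mul]
    ring
  rw [e]
  refine (eLpNorm_add_le (((hF s).smul (hF' s)).add ((hF s).smul h'.memLp_lim.1))
    (h.memLp_lim.1.smul (hF' s)) hr.out).trans ?_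
  refine add_le_add ((eLpNorm_add_le ((hF s).smul (hF' s)) ((hF s).smul h'.memLp_lim.1)
    hr.out).trans (add_le_add ?_ ?_)) ?_
  · exact eLpNorm_smul_le_mul_eLpNorm (hF' s) (hF s)
  · exact eLpNorm_smul_le_mul_eLpNorm h'.memLp_lim.1 (hF s)
  · exact eLpNorm_smul_le_mul_eLpNorm (hF' s) h.memLp_lim.1

theorem integral (h : TendstoLp 1 l f g) :
    Tendsto (fun s => ∫ x, f s x) l (𝓝 (∫ x, g x)) := by
  refine tendsto_integral_of_L1' g h.memLp_lim.1
    (Eventually.of_forall fun s => memLp_one_iff_integrable.1 (h.memLp s)) ?_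
  exact h.tendsto

theorem tendsto_eLpNorm [hp : Fact (1 ≤ p)] (h : TendstoLp p l f g) :
    Tendsto (fun s => (eLpNorm (f s) p volume).toReal) l (𝓝 (eLpNorm g p volume).toReal) := by
  rw [tendsto_iff_norm_sub_tendsto_zero]
  have t := (ENNReal.tendsto_toReal ENNReal.zero_ne_top).comp h.tendsto
  refine squeeze_zero (fun _ => norm_nonneg _) (fun s => ?_) t
  have hD : MemLp (fun x => f s x - g x) p volume := (h.memLp s).sub h.memLp_lim
  have h1 : eLpNorm (f s) p volume ≤
      eLpNorm (fun x => f s x - g x) p volume + eLpNorm g p volume := by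
    have := eLpNorm_add_le hD.1 h.memLp_lim.1 hp.out
    refine le_of_eq_of_le (congrArg (fun k => eLpNorm k p volume) (funext fun x => ?_)) this
    simp only [Pi.add_apply, sub_add_cancel]
  have h2 : eLpNorm g p volume ≤
      eLpNorm (fun x => f s x - g x) p volume + eLpNorm (f s) p volume := by
    have := eLpNorm_sub_le (h.memLp s).1 hD.1 hp.out
    rw [add_comm] at this
    refine le_of_eq_of_le (congrArg (fun k => eLpNorm k p volume) (funext fun x => ?_)) this
    simp only [Pi.sub_apply, sub_sub_cancel]
  have a1 := ENNReal.toReal_mono (ENNReal.add_ne_top.2 ⟨hD.2.ne, h.memLp_lim.2.ne⟩) h1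
  have a2 := ENNReal.toReal_mono (ENNReal.add_ne_top.2 ⟨hD.2.ne, (h.memLp s).2.ne⟩) h2
  rw [ENNReal.toReal_add hD.2.ne h.memLp_lim.2.ne] at a1
  rw [ENNReal.toReal_add hD.2.ne (h.memLp s).2.ne] at a2
  rw [Real.norm_eq_abs, abs_le, Function.comp_apply]
  constructor <;> linarith

end TendstoLp

/-! ### The algebra H¹. -/

/-- `f ∈ H¹(ℝ)`, with its locally absolutely continuous representative and derivative `f₁`. -/
structure HasH1Deriv (f f₁ : ℝ → ℂ) : Prop where
  hasACDeriv : HasACDeriv f f₁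
  memLp : MemLp f 2
  memLp_deriv : MemLp f₁ 2

namespace HasH1Deriv

variable {f f₁ g g₁ : ℝ → ℂ}

theorem zero : HasH1Deriv (fun _ => 0) (fun _ => 0) :=
  ⟨HasACDeriv.const 0, MemLp.zero, MemLp.zero⟩

theorem eLpNorm_top_le (h : HasH1Deriv f f₁) :
    eLpNorm f ∞ volume ≤ eLpNorm f 2 volume + eLpNorm f₁ 2 volume := by
  rw [eLpNorm_exponent_top]
  refine (eLpNormEssSup_le_of_ae_bound
    (ae_of_all _ (h.hasACDeriv.norm_le h.memLp h.memLp_deriv))).trans ?_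
  rw [← ENNReal.toReal_add h.memLp.2.ne h.memLp_deriv.2.ne,
    ENNReal.ofReal_toReal (ENNReal.add_ne_top.2 ⟨h.memLp.2.ne, h.memLp_deriv.2.ne⟩)]

theorem memLp_top (h : HasH1Deriv f f₁) : MemLp f ∞ :=
  ⟨h.memLp.1, h.eLpNorm_top_le.trans_lt
    (ENNReal.add_lt_top.2 ⟨h.memLp.2, h.memLp_deriv.2⟩)⟩

theorem congr (h : HasH1Deriv f f₁) (hf : ∀ x, f x = g x) (hf₁ : ∀ x, f₁ x = g₁ x) :
    HasH1Deriv g g₁ := by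
  obtain rfl : f = g := funext hf
  obtain rfl : f₁ = g₁ := funext hf₁
  exact h

theorem add (h : HasH1Deriv f f₁) (h' : HasH1Deriv g g₁) :
    HasH1Deriv (fun x => f x + g x) (fun x => f₁ x + g₁ x) :=
  ⟨h.hasACDeriv.add h'.hasACDeriv, h.memLp.add h'.memLp, h.memLp_deriv.add h'.memLp_deriv⟩

theorem sub (h : HasH1Deriv f f₁) (h' : HasH1Deriv g g₁) :
    HasH1Deriv (fun x => f x - g x) (fun x => f₁ x - g₁ x) :=
  ⟨h.hasACDeriv.sub h'.hasACDeriv, h.memLp.sub h'.memLp, h.memLp_deriv.sub h'.memLp_deriv⟩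

theorem const_mul (c : ℂ) (h : HasH1Deriv f f₁) :
    HasH1Deriv (fun x => c * f x) (fun x => c * f₁ x) :=
  ⟨h.hasACDeriv.const_mul c, h.memLp.const_mul c, h.memLp_deriv.const_mul c⟩

theorem star (h : HasH1Deriv f f₁) :
    HasH1Deriv (fun x => conj (f x)) (fun x => conj (f₁ x)) :=
  ⟨h.hasACDeriv.star, memLp_conj h.memLp, memLp_conj h.memLp_deriv⟩

theorem mul (h : HasH1Deriv f f₁) (h' : HasH1Deriv g g₁) :
    HasH1Deriv (fun x => f x * g x) (fun x => f₁ x * g x + f x * g₁ x) :=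
  ⟨h.hasACDeriv.mul h'.hasACDeriv, h'.memLp_top.mul' h.memLp,
    (h'.memLp_top.mul' h.memLp_deriv).add (h'.memLp_deriv.mul' h.memLp_top)⟩

theorem integrable_deriv_mul (h : HasH1Deriv f f₁) (h' : HasH1Deriv g g₁) :
    Integrable (fun x => f₁ x * g x + f x * g₁ x) :=
  (h.memLp_deriv.integrable_mul h'.memLp).add (h.memLp.integrable_mul h'.memLp_deriv)

theorem integral_deriv_mul (h : HasH1Deriv f f₁) (h' : HasH1Deriv g g₁) :
    ∫ x, (f₁ x * g x + f x * g₁ x) = 0 :=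
  (h.hasACDeriv.mul h'.hasACDeriv).integral_eq_zero (h.memLp.integrable_mul h'.memLp)
    (h.integrable_deriv_mul h')

end HasH1Deriv

/-- Convergence in `H¹(ℝ)` implies uniform convergence. -/
theorem TendstoLp.top_of_H1 {l : Filter ℝ} {f f₁ : ℝ → ℝ → ℂ} {g g₁ : ℝ → ℂ}
    (hf : ∀ s, HasH1Deriv (f s) (f₁ s)) (hg : HasH1Deriv g g₁)
    (h : TendstoLp 2 l f g) (h₁ : TendstoLp 2 l f₁ g₁) : TendstoLp ∞ l f g := by
  refine ⟨fun s => (hf s).memLp_top, hg.memLp_top, ?_⟩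
  have t := h.tendsto.add h₁.tendsto
  rw [add_zero] at t
  exact tendsto_of_tendsto_of_tendsto_of_le_of_le tendsto_const_nhds t
    (fun _ => zero_le) fun s => ((hf s).sub hg).eLpNorm_top_le

/-! ### Differentiating a functional from its exact increments. -/

theorem integrable_mul_of_memLp_two {f g : ℝ → ℂ} (hf : MemLp f 2) (hg : MemLp g 2) :
    Integrable (fun x => f x * g x) :=
  hf.integrable_mul hg

theorem re_integral_congr {f g : ℝ → ℂ} (hf : Integrable f) (hg : Integrable g)
    (h : ∀ x, (f x).re = (g x).re) : (∫ x, f x).re = (∫ x, g x).re := by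
  have e1 := integral_re hf
  have e2 := integral_re hg
  simp only [RCLike.re_to_complex] at e1 e2
  rw [← e1, ← e2]
  exact integral_congr_ae (ae_of_all _ h)

/-- Integration by parts for the real part of a difference of two densities. -/
theorem re_integral_sub_eq {F G D D₁ X X₁ Y : ℝ → ℂ} (hF : Integrable F) (hG : Integrable G)
    (hD : HasH1Deriv D D₁) (hX : HasH1Deriv X X₁) (hY : MemLp Y 2)
    (h : ∀ x, (F x - G x).re = (D₁ x * X x + D x * Y x).re) :
    (∫ x, F x).re - (∫ x, G x).re = (∫ x, D x * (Y x - X₁ x)).re := by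
  have i1 : Integrable (fun x => D x * (Y x - X₁ x)) :=
    hD.memLp.integrable_mul (hY.sub hX.memLp_deriv)
  have i2 := hD.integrable_deriv_mul hX
  rw [← Complex.sub_re, ← integral_sub hF hG]
  have e := re_integral_congr (hF.sub hG) (i1.add i2) (fun x => by
    simp only [Pi.sub_apply, Pi.add_apply]
    rw [h x]
    congr 1
    ring)
  simp only [Pi.sub_apply, Pi.add_apply] at e
  rw [e, integral_add i1 i2, hD.integral_deriv_mul hX, add_zero]

/-- The difference quotient of Φ is the real part of an L² pairing of two convergent factors. Only
L² differentiability of the curve is used. -/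
theorem hasDerivAt_of_sub_eq_re_integral {Φ : ℝ → ℝ} {t : ℝ} {a A : ℝ → ℝ → ℂ} {v : ℝ → ℂ}
    (ha : TendstoLp 2 (𝓝[≠] t) (fun s x => (((s - t)⁻¹ : ℝ) : ℂ) * (a s x - a t x)) v)
    (hA : TendstoLp 2 (𝓝 t) A (A t))
    (hΦ : ∀ s, Φ s - Φ t = (∫ x, (a s x - a t x) * A s x).re) :
    HasDerivAt Φ (∫ x, v x * A t x).re t := by
  rw [hasDerivAt_iff_tendsto_slope]
  have h := (ha.mul (r := 1) (hA.mono nhdsWithin_le_nhds)).integral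
  refine ((Complex.continuous_re.tendsto _).comp h).congr fun s => ?_
  simp only [Function.comp_apply, mul_assoc]
  rw [integral_const_mul, Complex.re_ofReal_mul, slope_def_field, hΦ, div_eq_inv_mul]

/-! ### Pointwise densities and their polynomial identities. -/

/-- `|z + q|² - q²` as a polynomial in `z` and its conjugate. -/
def excess (q : ℝ) (z : ℂ) : ℂ := z * conj z + q * conj z + q * z

/-- The first derivative of `excess q` along a curve through `z` with velocity `z₁`. -/
def excessDeriv (q : ℝ) (z z₁ : ℂ) : ℂ :=
  z₁ * conj z + z * conj z₁ + q * conj z₁ + q * z₁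

/-- `|z + q|² (z + q)^* - q³`. -/
def cubic (q : ℝ) (z : ℂ) : ℂ :=
  conj z * excess q z + q * excess q z + q ^ 2 * conj z

/-- The first derivative of `cubic q`. -/
def cubicDeriv (q : ℝ) (z z₁ : ℂ) : ℂ :=
  conj z₁ * excess q z + conj z * excessDeriv q z z₁ + q * excessDeriv q z z₁ + q ^ 2 * conj z₁

/-- `|z + q|⁴ - q⁴`. -/
def quartic (q : ℝ) (z : ℂ) : ℂ := excess q z * excess q z + 2 * q ^ 2 * excess q z

/-- The first derivative of `quartic q`. -/
def quarticDeriv (q : ℝ) (z z₁ : ℂ) : ℂ :=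
  excessDeriv q z z₁ * excess q z + excess q z * excessDeriv q z z₁ +
    2 * q ^ 2 * excessDeriv q z z₁

/-- `(z + q)^* z₁`, whose imaginary part is the current of `z + q`. -/
def current (q : ℝ) (z z₁ : ℂ) : ℂ := conj z * z₁ + q * z₁

/-- The first derivative of `current q`. -/
def currentDeriv (q : ℝ) (z z₁ z₂ : ℂ) : ℂ := conj z₁ * z₁ + conj z * z₂ + q * z₂

/-- The time derivative prescribed by the equation, for the perturbation `z` of `q`. -/
def velocity (q : ℝ) (z z₁ z₂ : ℂ) : ℂ := Complex.I * z₂ - (z + q) ^ 2 * conj z₁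

/-- Only the real part matters; the factor -i/2 turns half an imaginary part into a real part. -/
def energyDensity (q : ℝ) (z z₁ : ℂ) : ℂ :=
  z₁ * conj z₁ + -(Complex.I / 2) * (cubic q z * z₁) +
    1 / 6 * (excess q z * (excess q z * excess q z + 3 * q ^ 2 * excess q z))

def momentumDensity (q : ℝ) (z z₁ : ℂ) : ℂ :=
  -(Complex.I / 2) * (z * conj z₁) - 1 / 4 * (excess q z * excess q z)

/-- Turns an equality of real parts into a polynomial identity in the variables and their
conjugates, which `ring` can decide. -/
theorem re_eq_of_add_conj {z w : ℂ} (h : z + conj z = w + conj w) : z.re = w.re := by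
  rw [Complex.add_conj, Complex.add_conj] at h
  have := Complex.ofReal_injective h
  linarith

/-- The part of the variation of the energy that multiplies the derivative of the increment. -/
def energyVarX (q : ℝ) (b b₁ a a₁ : ℂ) : ℂ :=
  (conj b₁ + conj a₁) + -(Complex.I / 4) * (cubic q b + cubic q a)

/-- The derivative of `energyVarX`. -/
def energyVarXDeriv (q : ℝ) (b b₁ b₂ a a₁ a₂ : ℂ) : ℂ :=
  (conj b₂ + conj a₂) + -(Complex.I / 4) * (cubicDeriv q b b₁ + cubicDeriv q a a₁)

/-- The part of the variation of the energy that multiplies the increment. -/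
def energyVarY (q : ℝ) (b b₁ a a₁ : ℂ) : ℂ :=
  -(Complex.I / 8) * (((conj b + q) * (conj b + q) + (conj a + q) * (conj a + q)) * (b₁ + a₁)) +
    Complex.I / 8 *
      (((conj b + q) + (conj a + q)) * ((b + q) + (a + q)) * (conj b₁ + conj a₁)) +
    1 / 6 * (((conj b + q) + (conj a + q)) *
      (excess q b * excess q b + excess q a * excess q b + excess q a * excess q a +
        3 * q ^ 2 * (excess q b + excess q a)))

def momentumVarX (b a : ℂ) : ℂ := Complex.I / 4 * (conj b + conj a)

def momentumVarY (q : ℝ) (b b₁ a a₁ : ℂ) : ℂ :=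
  -(Complex.I / 4) * (conj b₁ + conj a₁) -
    1 / 4 * (((conj b + q) + (conj a + q)) * (excess q b + excess q a))

/-- The discrete product rule, with averages over the two endpoints. Terms carrying the conjugate of
b - a or b₁ - a₁ are conjugated as a whole, which the real part allows. -/
theorem energyDensity_sub_re (q : ℝ) (b b₁ a a₁ : ℂ) :
    (energyDensity q b b₁ - energyDensity q a a₁).re =
      ((b₁ - a₁) * energyVarX q b b₁ a a₁ + (b - a) * energyVarY q b b₁ a a₁).re := by
  apply re_eq_of_add_conj
  simp only [energyDensity, energyVarX, energyVarY, cubic, excess, map_add, map_sub, map_mul,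
    map_neg, map_div₀, map_pow, map_ofNat, map_one, Complex.conj_conj, Complex.conj_I,
    Complex.conj_ofReal]
  ring

theorem momentumDensity_sub_re (q : ℝ) (b b₁ a a₁ : ℂ) :
    (momentumDensity q b b₁ - momentumDensity q a a₁).re =
      ((b₁ - a₁) * momentumVarX b a + (b - a) * momentumVarY q b b₁ a a₁).re := by
  apply re_eq_of_add_conj
  simp only [momentumDensity, momentumVarX, momentumVarY, excess, map_add, map_sub, map_mul,
    map_neg, map_div₀, map_ofNat, map_one, Complex.conj_conj, Complex.conj_I,
    Complex.conj_ofReal]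
  ring

theorem excess_sub_re (q : ℝ) (b a : ℂ) :
    (excess q b - excess q a).re = ((b - a) * ((conj b + q) + (conj a + q))).re := by
  apply re_eq_of_add_conj
  simp only [excess, map_add, map_sub, map_mul, Complex.conj_conj, Complex.conj_ofReal]
  ring

/-- Conservation of energy in local form. -/
theorem energy_flux_re (q : ℝ) (z z₁ z₂ : ℂ) :
    (velocity q z z₁ z₂ * (energyVarY q z z₁ z z₁ - energyVarXDeriv q z z₁ z₂ z z₁ z₂)).re =
      ((conj (currentDeriv q z z₁ z₂) *
            (conj (current q z z₁) - current q z z₁) +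
          conj (current q z z₁) *
            (conj (currentDeriv q z z₁ z₂) - currentDeriv q z z₁ z₂)) +
        (quarticDeriv q z z₁ *
            (Complex.I * current q z z₁ - 1 / 8 * quartic q z) +
          quartic q z *
            (Complex.I * currentDeriv q z z₁ z₂ - 1 / 8 * quarticDeriv q z z₁))).re := by
  apply re_eq_of_add_conj
  -- In the variable u = z + q the excess is u ū - q², which simplifies the expansion.
  obtain ⟨u, rfl⟩ : ∃ u, z = u - q := ⟨z + q, by ring⟩
  simp only [velocity, energyVarY, energyVarXDeriv, current, currentDeriv, quartic, quarticDeriv,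
    cubicDeriv, excess, excessDeriv, map_add, map_sub, map_mul,
    map_neg, map_div₀, map_pow, map_ofNat, map_one, Complex.conj_conj, Complex.conj_I,
    Complex.conj_ofReal]
  ring_nf
  simp only [Complex.I_sq]
  ring

/-- Conservation of momentum in local form. -/
theorem momentum_flux_re (q : ℝ) (z z₁ z₂ : ℂ) :
    (velocity q z z₁ z₂ *
        (momentumVarY q z z₁ z z₁ - Complex.I / 4 * (conj z₁ + conj z₁))).re =
      ((z₂ * (1 / 2 * conj z₁) + z₁ * (1 / 2 * conj z₂)) +
        (excessDeriv q z z₁ * (-Complex.I * current q z z₁ + 1 / 6 * (excess q z * excess q z) +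
            q ^ 2 / 4 * excess q z) +
          excess q z * (-Complex.I * currentDeriv q z z₁ z₂ +
            1 / 6 * (excessDeriv q z z₁ * excess q z + excess q z * excessDeriv q z z₁) +
            q ^ 2 / 4 * excessDeriv q z z₁))).re := by
  apply re_eq_of_add_conj
  obtain ⟨u, rfl⟩ : ∃ u, z = u - q := ⟨z + q, by ring⟩
  simp only [velocity, momentumVarY, current, currentDeriv, excess, excessDeriv, map_add, map_sub,
    map_mul,
    map_neg, map_div₀, map_pow, map_ofNat, map_one, Complex.conj_conj, Complex.conj_I,
    Complex.conj_ofReal]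
  ring_nf
  simp only [Complex.I_sq]
  ring

/-- Conservation of mass in local form. -/
theorem mass_flux_re (q : ℝ) (z z₁ z₂ : ℂ) (c : ℝ) :
    (velocity q z z₁ z₂ * ((conj z + q + (conj z + q)) * c)).re =
      (c * (2 * Complex.I * currentDeriv q z z₁ z₂ - 1 / 2 * quarticDeriv q z z₁)).re := by
  apply re_eq_of_add_conj
  obtain ⟨u, rfl⟩ : ∃ u, z = u - q := ⟨z + q, by ring⟩
  simp only [velocity, currentDeriv, quarticDeriv, excess, excessDeriv, map_add, map_sub,
    map_mul,
    map_div₀, map_pow, map_ofNat, map_one, Complex.conj_conj, Complex.conj_I,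
    Complex.conj_ofReal]
  ring

/-! ### Membership of the densities in H¹ and L¹. -/

namespace HasH1Deriv

variable {w w₁ w₂ : ℝ → ℂ}

theorem excess (q : ℝ) (h : HasH1Deriv w w₁) :
    HasH1Deriv (fun x => DNLS.excess q (w x)) (fun x => excessDeriv q (w x) (w₁ x)) :=
  (((h.mul h.star).add (h.star.const_mul q)).add (h.const_mul q)).congr
    (fun _ => rfl) (fun _ => rfl)

theorem cubic (q : ℝ) (h : HasH1Deriv w w₁) :
    HasH1Deriv (fun x => DNLS.cubic q (w x)) (fun x => cubicDeriv q (w x) (w₁ x)) :=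
  (((h.star.mul (h.excess q)).add ((h.excess q).const_mul q)).add
    (h.star.const_mul (q ^ 2))).congr (fun _ => rfl) (fun _ => rfl)

theorem quartic (q : ℝ) (h : HasH1Deriv w w₁) :
    HasH1Deriv (fun x => DNLS.quartic q (w x)) (fun x => quarticDeriv q (w x) (w₁ x)) :=
  (((h.excess q).mul (h.excess q)).add ((h.excess q).const_mul (2 * q ^ 2))).congr
    (fun _ => rfl) (fun _ => rfl)

theorem current (q : ℝ) (h : HasH1Deriv w w₁) (h₁ : HasH1Deriv w₁ w₂) :
    HasH1Deriv (fun x => DNLS.current q (w x) (w₁ x))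
      (fun x => currentDeriv q (w x) (w₁ x) (w₂ x)) :=
  ((h.star.mul h₁).add (h₁.const_mul q)).congr (fun _ => rfl) (fun _ => rfl)

theorem integrable_energyDensity (q : ℝ) (h : HasH1Deriv w w₁) :
    Integrable (fun x => energyDensity q (w x) (w₁ x)) := by
  have e := h.excess q
  exact ((h.memLp_deriv.integrable_mul h.star.memLp_deriv).add
    (((h.cubic q).memLp.integrable_mul h.memLp_deriv).const_mul (-(Complex.I / 2)))).add
    ((e.memLp.integrable_mul ((e.mul e).add (e.const_mul (3 * q ^ 2))).memLp).const_mul (1 / 6))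

theorem integrable_momentumDensity (q : ℝ) (h : HasH1Deriv w w₁) :
    Integrable (fun x => momentumDensity q (w x) (w₁ x)) := by
  have e := h.excess q
  exact ((h.memLp.integrable_mul h.star.memLp_deriv).const_mul (-(Complex.I / 2))).sub
    ((e.memLp.integrable_mul e.memLp).const_mul (1 / 4))

end HasH1Deriv

/-! ### Continuity in time of the densities and variations. -/

/-- A curve in `H²(ℝ)`, given by absolutely continuous representatives, continuous at `t`. -/
structure ContinuousAtH2 (a a₁ a₂ : ℝ → ℝ → ℂ) (t : ℝ) : Prop where
  deriv : ∀ s, HasH1Deriv (a s) (a₁ s)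
  deriv₁ : ∀ s, HasH1Deriv (a₁ s) (a₂ s)
  tendsto : TendstoLp 2 (𝓝 t) a (a t)
  tendsto₁ : TendstoLp 2 (𝓝 t) a₁ (a₁ t)
  tendsto₂ : TendstoLp 2 (𝓝 t) a₂ (a₂ t)

namespace ContinuousAtH2

variable {a a₁ a₂ : ℝ → ℝ → ℂ} {t : ℝ}

theorem tendsto_top (h : ContinuousAtH2 a a₁ a₂ t) : TendstoLp ∞ (𝓝 t) a (a t) :=
  .top_of_H1 h.deriv (h.deriv t) h.tendsto h.tendsto₁

theorem add_const_top (q : ℝ) (h : ContinuousAtH2 a a₁ a₂ t) :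
    TendstoLp ∞ (𝓝 t) (fun s x => a s x + q) (fun x => a t x + q) :=
  h.tendsto_top.add (.const (memLp_top_const (q : ℂ)))

theorem conj_add_const_top (q : ℝ) (h : ContinuousAtH2 a a₁ a₂ t) :
    TendstoLp ∞ (𝓝 t) (fun s x => conj (a s x) + q) (fun x => conj (a t x) + q) :=
  h.tendsto_top.star.add (.const (memLp_top_const (q : ℂ)))

/-- In each product one factor converges in L² and the others uniformly, which is why both an L² and
an L^∞ version are kept. -/
theorem excess (q : ℝ) (h : ContinuousAtH2 a a₁ a₂ t) :
    TendstoLp 2 (𝓝 t) (fun s x => DNLS.excess q (a s x)) (fun x => DNLS.excess q (a t x)) :=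
  ((h.tendsto.mul h.tendsto_top.star).add (h.tendsto.star.const_mul q)).add
    (h.tendsto.const_mul q)

theorem excess_top (q : ℝ) (h : ContinuousAtH2 a a₁ a₂ t) :
    TendstoLp ∞ (𝓝 t) (fun s x => DNLS.excess q (a s x)) (fun x => DNLS.excess q (a t x)) :=
  ((h.tendsto_top.mul h.tendsto_top.star).add (h.tendsto_top.star.const_mul q)).add
    (h.tendsto_top.const_mul q)

theorem excessDeriv (q : ℝ) (h : ContinuousAtH2 a a₁ a₂ t) :
    TendstoLp 2 (𝓝 t) (fun s x => DNLS.excessDeriv q (a s x) (a₁ s x))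
      (fun x => DNLS.excessDeriv q (a t x) (a₁ t x)) :=
  (((h.tendsto₁.mul h.tendsto_top.star).add (h.tendsto_top.mul h.tendsto₁.star)).add
    (h.tendsto₁.star.const_mul q)).add (h.tendsto₁.const_mul q)

theorem cubicDeriv (q : ℝ) (h : ContinuousAtH2 a a₁ a₂ t) :
    TendstoLp 2 (𝓝 t) (fun s x => DNLS.cubicDeriv q (a s x) (a₁ s x))
      (fun x => DNLS.cubicDeriv q (a t x) (a₁ t x)) :=
  (((h.tendsto₁.star.mul (h.excess_top q)).add (h.tendsto_top.star.mul (h.excessDeriv q))).add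
    ((h.excessDeriv q).const_mul q)).add (h.tendsto₁.star.const_mul (q ^ 2))

theorem quartic (q : ℝ) (h : ContinuousAtH2 a a₁ a₂ t) :
    TendstoLp 2 (𝓝 t) (fun s x => DNLS.quartic q (a s x)) (fun x => DNLS.quartic q (a t x)) :=
  ((h.excess q).mul (h.excess_top q)).add ((h.excess q).const_mul (2 * q ^ 2))

theorem current (q : ℝ) (h : ContinuousAtH2 a a₁ a₂ t) :
    TendstoLp 2 (𝓝 t) (fun s x => DNLS.current q (a s x) (a₁ s x))
      (fun x => DNLS.current q (a t x) (a₁ t x)) :=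
  (h.tendsto_top.star.mul h.tendsto₁).add (h.tendsto₁.const_mul q)

theorem energyVarXDeriv (q : ℝ) (h : ContinuousAtH2 a a₁ a₂ t) :
    TendstoLp 2 (𝓝 t)
      (fun s x => DNLS.energyVarXDeriv q (a s x) (a₁ s x) (a₂ s x) (a t x) (a₁ t x) (a₂ t x))
      (fun x => DNLS.energyVarXDeriv q (a t x) (a₁ t x) (a₂ t x) (a t x) (a₁ t x) (a₂ t x)) :=
  (h.tendsto₂.star.add (.const h.tendsto₂.star.memLp_lim)).add
    (((h.cubicDeriv q).add (.const (h.cubicDeriv q).memLp_lim)).const_mul (-(Complex.I / 4)))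

theorem energyVarY (q : ℝ) (h : ContinuousAtH2 a a₁ a₂ t) :
    TendstoLp 2 (𝓝 t)
      (fun s x => DNLS.energyVarY q (a s x) (a₁ s x) (a t x) (a₁ t x))
      (fun x => DNLS.energyVarY q (a t x) (a₁ t x) (a t x) (a₁ t x)) := by
  have hu := h.add_const_top q
  have hv := h.conj_add_const_top q
  -- The second endpoint of the variation is frozen at time t and enters as a constant curve.
  have cu : TendstoLp ∞ (𝓝 t) _ _ := .const hu.memLp_lim
  have cv : TendstoLp ∞ (𝓝 t) _ _ := .const hv.memLp_lim
  have c₁ : TendstoLp 2 (𝓝 t) _ _ := .const h.tendsto₁.memLp_lim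
  have he := h.excess q
  have he' := h.excess_top q
  have ce : TendstoLp 2 (𝓝 t) _ _ := .const he.memLp_lim
  have ce' : TendstoLp ∞ (𝓝 t) _ _ := .const he'.memLp_lim
  exact (((((hv.mul (r := ∞) hv).add (cv.mul cv)).mul (h.tendsto₁.add c₁)).const_mul
      (-(Complex.I / 8))).add
    ((((hv.add cv).mul (r := ∞) (hu.add cu)).mul (h.tendsto₁.star.add c₁.star)).const_mul
      (Complex.I / 8))).add
    (((hv.add cv).mul ((((he.mul he').add (ce.mul he')).add (ce.mul ce')).add
      ((he.add ce).const_mul (3 * q ^ 2)))).const_mul (1 / 6))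

theorem momentumVarY (q : ℝ) (h : ContinuousAtH2 a a₁ a₂ t) :
    TendstoLp 2 (𝓝 t)
      (fun s x => DNLS.momentumVarY q (a s x) (a₁ s x) (a t x) (a₁ t x))
      (fun x => DNLS.momentumVarY q (a t x) (a₁ t x) (a t x) (a₁ t x)) := by
  have hv := h.conj_add_const_top q
  have cv : TendstoLp ∞ (𝓝 t) _ _ := .const hv.memLp_lim
  have c₁ : TendstoLp 2 (𝓝 t) _ _ := .const h.tendsto₁.memLp_lim
  have he := h.excess q
  have ce : TendstoLp 2 (𝓝 t) _ _ := .const he.memLp_lim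
  exact ((h.tendsto₁.star.add c₁.star).const_mul (-(Complex.I / 4))).sub
    (((hv.add cv).mul (he.add ce)).const_mul (1 / 4))

/-- The flux of mass, whose real part is `-2 Im(u^* ∂u) - (|u|⁴ - q⁴) / 2`. -/
theorem massFlux (q : ℝ) (h : ContinuousAtH2 a a₁ a₂ t) :
    TendstoLp 2 (𝓝 t)
      (fun s x => 2 * Complex.I * DNLS.current q (a s x) (a₁ s x) - 1 / 2 * DNLS.quartic q (a s x))
      (fun x => 2 * Complex.I * DNLS.current q (a t x) (a₁ t x) - 1 / 2 * DNLS.quartic q (a t x)) :=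
  ((h.current q).const_mul (2 * Complex.I)).sub ((h.quartic q).const_mul (1 / 2))

end ContinuousAtH2

/-! ### Time derivatives of energy, momentum and truncated mass. -/

/-- The curve `a` solves the equation for the perturbation of `q` at time `t`, in `L²(ℝ)`. -/
structure SolvesAt (q : ℝ) (a a₁ a₂ : ℝ → ℝ → ℂ) (t : ℝ) : Prop
    extends ContinuousAtH2 a a₁ a₂ t where
  hasDeriv : TendstoLp 2 (𝓝[≠] t) (fun s x => (((s - t)⁻¹ : ℝ) : ℂ) * (a s x - a t x))
    (fun x => velocity q (a t x) (a₁ t x) (a₂ t x))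

namespace SolvesAt

variable {q : ℝ} {a a₁ a₂ : ℝ → ℝ → ℂ} {t : ℝ}

theorem hasDerivAt_energy (h : SolvesAt q a a₁ a₂ t) :
    HasDerivAt (fun s => (∫ x, energyDensity q (a s x) (a₁ s x)).re) 0 t := by
  have hc := h.toContinuousAtH2
  have hA := (hc.energyVarY q).sub (hc.energyVarXDeriv q)
  have key := hasDerivAt_of_sub_eq_re_integral (Φ := fun s =>
    (∫ x, energyDensity q (a s x) (a₁ s x)).re) h.hasDeriv hA (fun s => by
      have ds := h.deriv s
      have dt := h.deriv t
      have ds₁ := h.deriv₁ s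
      have dt₁ := h.deriv₁ t
      exact re_integral_sub_eq (ds.integrable_energyDensity q) (dt.integrable_energyDensity q)
        (ds.sub dt)
        ((ds₁.star.add dt₁.star).add (((ds.cubic q).add (dt.cubic q)).const_mul
          (-(Complex.I / 4))))
        ((hc.energyVarY q).memLp s) (fun x => energyDensity_sub_re q _ _ _ _))
  convert key using 1
  have dt := h.deriv t
  have dt₁ := h.deriv₁ t
  have dP := dt.current q dt₁
  have dτ := dt.quartic q
  -- `R1` and `R2` are the second factors of the two products whose derivatives make up the energy
  -- flux.
  have R1 := dP.star.sub dP
  have R2 := (dP.const_mul Complex.I).sub (dτ.const_mul (1 / 8))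
  have i1 := dP.star.integrable_deriv_mul R1
  have i2 := dτ.integrable_deriv_mul R2
  have iv := integrable_mul_of_memLp_two h.hasDeriv.memLp_lim hA.memLp_lim
  have := re_integral_congr iv (i1.add i2) (fun x => energy_flux_re q _ _ _)
  refine Eq.trans ?_ this.symm
  simp only [Pi.add_apply]
  rw [integral_add i1 i2, dP.star.integral_deriv_mul R1, dτ.integral_deriv_mul R2, add_zero,
    Complex.zero_re]

theorem hasDerivAt_momentum (h : SolvesAt q a a₁ a₂ t) :
    HasDerivAt (fun s => (∫ x, momentumDensity q (a s x) (a₁ s x)).re) 0 t := by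
  have hc := h.toContinuousAtH2
  have hA := (hc.momentumVarY q).sub
    ((h.tendsto₁.star.add (.const h.tendsto₁.star.memLp_lim)).const_mul (Complex.I / 4))
  have key := hasDerivAt_of_sub_eq_re_integral (Φ := fun s =>
    (∫ x, momentumDensity q (a s x) (a₁ s x)).re) h.hasDeriv hA (fun s => by
      have ds := h.deriv s
      have dt := h.deriv t
      exact re_integral_sub_eq (ds.integrable_momentumDensity q)
        (dt.integrable_momentumDensity q) (ds.sub dt)
        ((ds.star.add dt.star).const_mul (Complex.I / 4))
        ((hc.momentumVarY q).memLp s) (fun x => momentumDensity_sub_re q _ _ _ _))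
  convert key using 1
  have dt := h.deriv t
  have dt₁ := h.deriv₁ t
  have dP := dt.current q dt₁
  have de := dt.excess q
  have R1 := dt₁.star.const_mul (1 / 2)
  have R2 := ((dP.const_mul (-Complex.I)).add ((de.mul de).const_mul (1 / 6))).add
    (de.const_mul (q ^ 2 / 4))
  have i1 := dt₁.integrable_deriv_mul R1
  have i2 := de.integrable_deriv_mul R2
  have iv := integrable_mul_of_memLp_two h.hasDeriv.memLp_lim hA.memLp_lim
  have := re_integral_congr iv (i1.add i2) (fun x => momentum_flux_re q _ _ _)
  refine Eq.trans ?_ this.symm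
  simp only [Pi.add_apply]
  rw [integral_add i1 i2, dt₁.integral_deriv_mul R1, de.integral_deriv_mul R2, add_zero,
    Complex.zero_re]

/-- The local mass law is tested against η and the space derivative is moved onto η, so that only
the L² norm of the flux is needed. -/
theorem hasDerivAt_mass (h : SolvesAt q a a₁ a₂ t) {η η₁ : ℝ → ℝ}
    (hη : HasH1Deriv (fun x => (η x : ℂ)) (fun x => (η₁ x : ℂ))) :
    HasDerivAt (fun s => (∫ x, excess q (a s x) * η x).re)
      (-∫ x, η₁ x * (2 * Complex.I * current q (a t x) (a₁ t x) -
        1 / 2 * quartic q (a t x))).re t := by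
  have hc := h.toContinuousAtH2
  have hv := hc.conj_add_const_top q
  have hA : TendstoLp 2 (𝓝 t) _ _ := (hv.add (.const hv.memLp_lim)).mul (.const hη.memLp)
  have key := hasDerivAt_of_sub_eq_re_integral (Φ := fun s =>
    (∫ x, excess q (a s x) * η x).re) h.hasDeriv hA (fun s => by
      have ds := h.deriv s
      have dt := h.deriv t
      -- The mass density contains no derivative, so the part X of the variation is 0.
      have e := re_integral_sub_eq
        (integrable_mul_of_memLp_two (ds.excess q).memLp hη.memLp)
        (integrable_mul_of_memLp_two (dt.excess q).memLp hη.memLp) (ds.sub dt) HasH1Deriv.zero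
        (hA.memLp s) (fun x => by
          simp only [mul_zero, zero_add]
          rw [← sub_mul, ← mul_assoc, Complex.re_mul_ofReal, Complex.re_mul_ofReal,
            excess_sub_re])
      simpa only [sub_zero] using e)
  convert key using 1
  have dt := h.deriv t
  have dt₁ := h.deriv₁ t
  have dF := ((dt.current q dt₁).const_mul (2 * Complex.I)).sub
    ((dt.quartic q).const_mul (1 / 2))
  have iv := integrable_mul_of_memLp_two h.hasDeriv.memLp_lim hA.memLp_lim
  have i1 := integrable_mul_of_memLp_two hη.memLp dF.memLp_deriv
  have i2 := integrable_mul_of_memLp_two hη.memLp_deriv dF.memLp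
  have := re_integral_congr iv i1 (fun x => mass_flux_re q _ _ _ _)
  refine Eq.trans ?_ this.symm
  have e := hη.integral_deriv_mul dF
  have e2 := integral_add i2 i1
  rw [e2] at e
  rw [eq_neg_of_add_eq_zero_right e]

end SolvesAt

/-! ### From solutions to curves of representatives. -/

theorem HasWeakDeriv.congr_ae {f g F : ℝ → ℂ} (h : HasWeakDeriv F g) (hf : f =ᵐ[volume] F) :
    HasWeakDeriv f g := by
  refine ⟨fun x => (h.1 x).congr hf.symm, h.2.1, fun φ hφ hφc => ?_⟩
  rw [← h.2.2 φ hφ hφc]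
  refine integral_congr_ae ?_
  filter_upwards [hf] with x hx
  rw [hx]

theorem HasH1Deriv.weakDeriv_ae_eq {w w₁ f : ℝ → ℂ} (h : HasH1Deriv w w₁) (q : ℂ)
    (hf : f =ᵐ[volume] fun x => w x + q) : weakDeriv f =ᵐ[volume] w₁ :=
  (((h.hasACDeriv.add_const q).hasWeakDeriv
    (h.memLp_deriv.locallyIntegrable one_le_two)).congr_ae hf).weakDeriv_ae_eq

theorem tendstoLp_of_tendsto {l : Filter ℝ} {f : ℝ → ℝ → ℂ} {g : ℝ → ℂ} {W : ℝ → L2} {G : L2}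
    (hf : ∀ s, MemLp (f s) 2) (hW : ∀ᶠ s in l, f s =ᵐ[volume] W s) (hG : g =ᵐ[volume] G)
    (h : Tendsto W l (𝓝 G)) : TendstoLp 2 l f g := by
  refine ⟨hf, (memLp_congr_ae hG).2 (Lp.memLp G), ?_⟩
  rw [tendsto_iff_edist_tendsto_0] at h
  refine h.congr' ?_
  filter_upwards [hW] with s hs
  rw [Lp.edist_def]
  exact eLpNorm_congr_ae (hs.symm.sub hG.symm)

theorem exists_hasH1Deriv_of_hasWeakDeriv {f f₁ f₂ : ℝ → ℂ} (h : HasWeakDeriv f f₁)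
    (h₁ : HasWeakDeriv f₁ f₂) (m : MemLp f 2) (m₁ : MemLp f₁ 2) (m₂ : MemLp f₂ 2) :
    ∃ F F₁ : ℝ → ℂ, f =ᵐ[volume] F ∧ f₁ =ᵐ[volume] F₁ ∧ HasH1Deriv F F₁ ∧ HasH1Deriv F₁ f₂ := by
  obtain ⟨F, hF, dF⟩ := h.exists_hasACDeriv
  obtain ⟨F₁, hF₁, dF₁⟩ := h₁.exists_hasACDeriv
  exact ⟨F, F₁, hF, hF₁, ⟨dF.congr_ae hF₁, (memLp_congr_ae hF).1 m, (memLp_congr_ae hF₁).1 m₁⟩,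
    ⟨dF₁, (memLp_congr_ae hF₁).1 m₁, m₂⟩⟩

/-- A solution is represented by a curve of absolutely continuous functions. -/
theorem IsSolution.exists_solvesAt {q : ℝ} {u₀ : ℝ → ℂ} {J : Set ℝ} {u : ℝ → ℝ → ℂ}
    (hu : IsSolution q u₀ J u) :
    ∃ a a₁ a₂ : ℝ → ℝ → ℂ, ∀ t ∈ J, SolvesAt q a a₁ a₂ t ∧
      u t =ᵐ[volume] fun x => a t x + q := by
  obtain ⟨W, W₁, W₂, hW, hW₁, hW₂, H⟩ := hu.continuousOn
  obtain ⟨ut, ⟨W', V, -, H'⟩, heq⟩ := hu.equation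
  have hex : ∀ t, ∃ F F₁ F₂ : ℝ → ℂ, HasH1Deriv F F₁ ∧ HasH1Deriv F₁ F₂ ∧
      (t ∈ J → F =ᵐ[volume] W t ∧ F₁ =ᵐ[volume] W₁ t ∧ F₂ =ᵐ[volume] W₂ t) := by
    intro t
    by_cases ht : t ∈ J
    · obtain ⟨F, F₁, hF, hF₁, dF, dF₁⟩ := exists_hasH1Deriv_of_hasWeakDeriv
        (H t ht).2.1 (H t ht).2.2 (Lp.memLp _) (Lp.memLp _) (Lp.memLp _)
      exact ⟨F, F₁, W₂ t, dF, dF₁, fun _ => ⟨hF.symm, hF₁.symm, ae_eq_rfl⟩⟩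
    -- `TendstoLp` asks for membership in Lᵖ at every parameter, so the curve is set to 0 outside J.
    · exact ⟨_, _, _, HasH1Deriv.zero, HasH1Deriv.zero, fun h => absurd h ht⟩
  choose a a₁ a₂ d d₁ hJ using hex
  have hau : ∀ t ∈ J, u t =ᵐ[volume] fun x => a t x + q := by
    intro t ht
    filter_upwards [(H t ht).1, (hJ t ht).1] with x h1 h2
    rw [h2, ← h1]
    ring
  refine ⟨a, a₁, a₂, fun t ht => ⟨⟨⟨d, d₁, ?_, ?_, ?_⟩, ?_⟩, hau t ht⟩⟩
  · exact tendstoLp_of_tendsto (fun s => (d s).memLp)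
      ((hu.isOpen.eventually_mem ht).mono fun s hs => (hJ s hs).1) (hJ t ht).1
      (hW.continuousAt (hu.isOpen.mem_nhds ht))
  · exact tendstoLp_of_tendsto (fun s => (d s).memLp_deriv)
      ((hu.isOpen.eventually_mem ht).mono fun s hs => (hJ s hs).2.1) (hJ t ht).2.1
      (hW₁.continuousAt (hu.isOpen.mem_nhds ht))
  · exact tendstoLp_of_tendsto (fun s => (d₁ s).memLp_deriv)
      ((hu.isOpen.eventually_mem ht).mono fun s hs => (hJ s hs).2.2) (hJ t ht).2.2
      (hW₂.continuousAt (hu.isOpen.mem_nhds ht))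
  -- The L² curve that is differentiated need not be the one from H² continuity; on J both represent
  -- u - q₀ almost everywhere.
  · have haW : ∀ s ∈ J, a s =ᵐ[volume] W' s := by
      intro s hs
      filter_upwards [(hJ s hs).1, (H s hs).1, (H' s hs).1] with x h1 h2 h3
      rw [h1, ← h2, h3]
    refine tendstoLp_of_tendsto (fun s => ((d s).memLp.sub (d t).memLp).const_mul _) ?_ ?_
      (hasDerivAt_iff_tendsto_slope.1 (H' t ht).2.2)
    · filter_upwards [(hu.isOpen.eventually_mem ht).filter_mono nhdsWithin_le_nhds] with s hs
      rw [slope_def_module]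
      filter_upwards [haW s hs, haW t ht, Lp.coeFn_smul (s - t)⁻¹ (W' s - W' t),
        Lp.coeFn_sub (W' s) (W' t)] with x h1 h2 h3 h4
      rw [h3, Pi.smul_apply, h4, Pi.sub_apply, h1, h2, Complex.real_smul]
    · have e1 := (d t).weakDeriv_ae_eq q (hau t ht)
      have e2 := (d₁ t).weakDeriv_ae_eq 0 (f := weakDeriv (u t)) (by simpa using e1)
      filter_upwards [heq t ht, e1, e2, hau t ht, (H' t ht).2.1] with x h1 h2 h3 h4 h5
      rw [h2, h3, h4] at h1
      rw [← h5, velocity]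
      linear_combination Complex.I * h1 - (ut t x + (a t x + q) ^ 2 * conj (a₁ t x)) *
        Complex.I_sq

/-! ### Matching the densities with energy and momentum. -/

theorem excess_eq_ofReal (q : ℝ) (z : ℂ) : excess q z = ((‖z + q‖ ^ 2 - q ^ 2 : ℝ) : ℂ) := by
  have := Complex.mul_conj' (z + q)
  push_cast
  rw [← this, map_add, Complex.conj_ofReal, excess]
  ring

theorem cubic_eq (q : ℝ) (z : ℂ) :
    cubic q z = ((‖z + q‖ ^ 2 : ℝ) : ℂ) * conj (z + q) - (q : ℂ) ^ 3 := by
  have := Complex.mul_conj' (z + q)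
  push_cast
  rw [← this, map_add, Complex.conj_ofReal, cubic, excess]
  ring

/-- `weakDeriv f` is a choice agreeing with w₁ only almost everywhere, so each of the three
integrals is transferred by almost everywhere equality. -/
theorem hasEnergy_of_hasH1Deriv {q : ℝ} {f w w₁ : ℝ → ℂ} (h : HasH1Deriv w w₁)
    (hf : f =ᵐ[volume] fun x => w x + q) :
    HasEnergy q f (∫ x, energyDensity q (w x) (w₁ x)).re := by
  have hf₁ := h.weakDeriv_ae_eq q hf
  have de := h.excess q
  set r : ℝ → ℝ := fun x => (‖w x + q‖ ^ 2 - q ^ 2) ^ 2 * (‖w x + q‖ ^ 2 + 2 * q ^ 2) with hr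
  have er : ∀ x, excess q (w x) *
      (excess q (w x) * excess q (w x) + 3 * q ^ 2 * excess q (w x)) = ((r x : ℝ) : ℂ) := by
    intro x
    rw [excess_eq_ofReal, hr]
    push_cast
    ring
  have e1 : ∀ x, w₁ x * conj (w₁ x) = ((‖w₁ x‖ ^ 2 : ℝ) : ℂ) := fun x => by
    rw [Complex.mul_conj']
    push_cast
    rfl
  have j1 := integrable_mul_of_memLp_two h.memLp_deriv h.star.memLp_deriv
  have j2 := integrable_mul_of_memLp_two (h.cubic q).memLp h.memLp_deriv
  have j3 := integrable_mul_of_memLp_two de.memLp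
    ((de.mul de).add (de.const_mul (3 * q ^ 2))).memLp
  simp only [er] at j3
  simp only [e1] at j1
  have c1 : (fun x => ‖weakDeriv f x‖ ^ 2) =ᵐ[volume] fun x => ‖w₁ x‖ ^ 2 := by
    filter_upwards [hf₁] with x h1
    rw [h1]
  have c2 : (fun x => (((‖f x‖ ^ 2 : ℝ) : ℂ) * conj (f x) - (q : ℂ) ^ 3) * weakDeriv f x)
      =ᵐ[volume] fun x => cubic q (w x) * w₁ x := by
    filter_upwards [hf₁, hf] with x h1 h2
    rw [h1, h2, cubic_eq]
  have c3 : (fun x => (‖f x‖ ^ 2 - |q| ^ 2) ^ 2 * (‖f x‖ ^ 2 + 2 * |q| ^ 2)) =ᵐ[volume] r := by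
    filter_upwards [hf] with x h1
    rw [h1, sq_abs]
  have k1 : Integrable (fun x => ‖w₁ x‖ ^ 2) := by
    simpa only [RCLike.re_to_complex, Complex.ofReal_re] using j1.re
  have k3 : Integrable r := by
    simpa only [RCLike.re_to_complex, Complex.ofReal_re] using j3.re
  refine ⟨k1.congr c1.symm, j2.congr c2.symm, k3.congr c3.symm, ?_⟩
  rw [integral_congr_ae c1, integral_congr_ae c2, integral_congr_ae c3]
  have e : ∀ x, energyDensity q (w x) (w₁ x) = ((‖w₁ x‖ ^ 2 : ℝ) : ℂ) +
      -(Complex.I / 2) * (cubic q (w x) * w₁ x) + 1 / 6 * ((r x : ℝ) : ℂ) := fun x => by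
    rw [energyDensity, er, e1]
  simp only [e]
  have j12 := j1.add (j2.const_mul (-(Complex.I / 2)))
  simp only [Pi.add_def] at j12
  rw [integral_add j12 (j3.const_mul _), integral_add j1 (j2.const_mul _), integral_const_mul,
    integral_const_mul, integral_complex_ofReal, integral_complex_ofReal]
  simp

theorem hasMomentum_of_hasH1Deriv {q : ℝ} {f w w₁ : ℝ → ℂ} (h : HasH1Deriv w w₁)
    (hf : f =ᵐ[volume] fun x => w x + q) :
    HasMomentum q f (∫ x, momentumDensity q (w x) (w₁ x)).re := by
  have hf₁ := h.weakDeriv_ae_eq q hf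
  have de := h.excess q
  set r : ℝ → ℝ := fun x => 1 / 4 * (‖w x + q‖ ^ 2 - q ^ 2) ^ 2 with hr
  have er : ∀ x, 1 / 4 * (excess q (w x) * excess q (w x)) = ((r x : ℝ) : ℂ) := by
    intro x
    rw [excess_eq_ofReal, hr]
    push_cast
    ring
  have j2 := integrable_mul_of_memLp_two h.memLp h.star.memLp_deriv
  have j3 := (integrable_mul_of_memLp_two de.memLp de.memLp).const_mul (1 / 4)
  simp only [er] at j3
  have c2 : (fun x => (f x - (q : ℂ)) * conj (weakDeriv f x))
      =ᵐ[volume] fun x => w x * conj (w₁ x) := by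
    filter_upwards [hf₁, hf] with x h1 h2
    rw [h1, h2, add_sub_cancel_right]
  have c3 : (fun x => 1 / 4 * (‖f x‖ ^ 2 - |q| ^ 2) ^ 2) =ᵐ[volume] r := by
    filter_upwards [hf] with x h1
    rw [h1, sq_abs]
  have k3 : Integrable r := by
    simpa only [RCLike.re_to_complex, Complex.ofReal_re] using j3.re
  refine ⟨j2.congr c2.symm, k3.congr c3.symm, ?_⟩
  rw [integral_congr_ae c2, integral_congr_ae c3]
  have e : ∀ x, momentumDensity q (w x) (w₁ x) =
      -(Complex.I / 2) * (w x * conj (w₁ x)) - ((r x : ℝ) : ℂ) := fun x => by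
    rw [momentumDensity, er]
  simp only [e]
  rw [integral_sub (j2.const_mul _) j3, integral_const_mul, integral_complex_ofReal]
  simp

/-! ### Removing the cutoff in the mass. -/

theorem abs_re_integral_mul_le {f g : ℝ → ℂ} (hf : MemLp f 2) (hg : MemLp g 2) :
    |(∫ x, f x * g x).re| ≤ (eLpNorm f 2 volume).toReal * (eLpNorm g 2 volume).toReal := by
  refine (Complex.abs_re_le_norm _).trans ((norm_integral_le_integral_norm _).trans ?_)
  rw [integral_norm_eq_lintegral_enorm (integrable_mul_of_memLp_two hf hg).1,
    ← eLpNorm_one_eq_lintegral_enorm, ← ENNReal.toReal_mul]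
  have h : eLpNorm (f • g) 1 volume ≤ eLpNorm f 2 volume * eLpNorm g 2 volume :=
    eLpNorm_smul_le_mul_eLpNorm hg.1 hf.1
  exact ENNReal.toReal_mono (ENNReal.mul_ne_top hf.2.ne hg.2.ne) h

theorem hasH1Deriv_cutoff {χ : ℝ → ℝ} (hχ : ContDiff ℝ 1 χ) (hc : HasCompactSupport χ)
    {R : ℝ} (hR : 0 < R) :
    HasH1Deriv (fun x => (χ (x / R) : ℂ)) (fun x => ((R⁻¹ * deriv χ (x / R) : ℝ) : ℂ)) := by
  have hd : ∀ x, HasDerivAt (fun x => (χ (x / R) : ℂ)) ((R⁻¹ * deriv χ (x / R) : ℝ) : ℂ) x := by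
    intro x
    have h1 := ((hχ.differentiable one_ne_zero (x / R)).hasDerivAt).comp x
      ((hasDerivAt_id x).div_const R)
    rw [mul_comm, one_div] at h1
    exact h1.ofReal_comp
  have hcR : HasCompactSupport (fun x => χ (x / R)) := by
    have := hc.comp_homeomorph (Homeomorph.mulRight₀ R⁻¹ (inv_ne_zero hR.ne'))
    simpa [Function.comp_def, div_eq_mul_inv] using this
  have hcR' : HasCompactSupport (fun x => deriv χ (x / R)) := by
    have := hc.deriv.comp_homeomorph (Homeomorph.mulRight₀ R⁻¹ (inv_ne_zero hR.ne'))
    simpa [Function.comp_def, div_eq_mul_inv] using this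
  have hcont : Continuous (fun x => ((R⁻¹ * deriv χ (x / R) : ℝ) : ℂ)) :=
    Complex.continuous_ofReal.comp (continuous_const.mul
      ((hχ.continuous_deriv le_rfl).comp (continuous_id.div_const R)))
  have hcd : ContDiff ℝ 1 (fun x => (χ (x / R) : ℂ)) :=
    Complex.ofRealCLM.contDiff.comp (hχ.comp (contDiff_id.div_const R))
  refine ⟨?_, hcd.continuous.memLp_of_hasCompactSupport (hcR.comp_left Complex.ofReal_zero),
    hcont.memLp_of_hasCompactSupport
      ((hcR'.comp_left (g := fun y => R⁻¹ * y) (mul_zero _)).comp_left Complex.ofReal_zero)⟩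
  have := HasACDeriv.of_contDiff hcd
  rwa [funext fun x => (hd x).deriv] at this

/-- By scaling, the squared norm is R⁻¹ ∫ (χ')². This decay lets a flux that is merely in L²
suffice. -/
theorem tendsto_eLpNorm_deriv_cutoff {χ : ℝ → ℝ} (hχ : ContDiff ℝ 1 χ)
    (hc : HasCompactSupport χ) :
    Tendsto (fun R : ℝ => (eLpNorm (fun x => ((R⁻¹ * deriv χ (x / R) : ℝ) : ℂ)) 2
      volume).toReal) atTop (𝓝 0) := by
  have key : ∀ R : ℝ, 0 < R → (eLpNorm (fun x => ((R⁻¹ * deriv χ (x / R) : ℝ) : ℂ)) 2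
      volume).toReal = (R⁻¹ * ∫ x, (deriv χ x) ^ 2) ^ ((2 : ℝ)⁻¹) := by
    intro R hR
    rw [(hasH1Deriv_cutoff hχ hc hR).memLp_deriv.eLpNorm_eq_integral_rpow_norm two_ne_zero
      ENNReal.ofNat_ne_top]
    have e : ∫ x, ‖((R⁻¹ * deriv χ (x / R) : ℝ) : ℂ)‖ ^ (ENNReal.toReal 2) =
        R⁻¹ * ∫ x, (deriv χ x) ^ 2 := by
      have := Measure.integral_comp_div (fun x => R⁻¹ ^ 2 * (deriv χ x) ^ 2) R
      rw [integral_const_mul, integral_const_mul, abs_of_pos hR, smul_eq_mul] at this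
      calc _ = ∫ x, R⁻¹ ^ 2 * deriv χ (x / R) ^ 2 := by
            refine integral_congr_ae (ae_of_all _ fun x => ?_)
            simp only [Complex.norm_real, ENNReal.toReal_ofNat, Real.rpow_ofNat,
              Real.norm_eq_abs, sq_abs]
            ring
        _ = _ := by
            rw [integral_const_mul, this]
            field_simp
    rw [e, ENNReal.toReal_ofReal, ENNReal.toReal_ofNat]
    exact Real.rpow_nonneg (mul_nonneg (inv_nonneg.2 hR.le)
      (integral_nonneg fun x => sq_nonneg _)) _
  have h1 : Tendsto (fun R : ℝ => (R⁻¹ * ∫ x, (deriv χ x) ^ 2) ^ ((2 : ℝ)⁻¹)) atTop (𝓝 0) := by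
    have := (tendsto_inv_atTop_zero.mul_const (∫ x, (deriv χ x) ^ 2)).rpow_const
      (p := (2 : ℝ)⁻¹) (Or.inr (by norm_num))
    simpa using this
  refine h1.congr' ?_
  filter_upwards [eventually_gt_atTop 0] with R hR using (key R hR).symm

theorem tendsto_integral_mul_cutoff {χ : ℝ → ℝ} (hχ : Continuous χ) (hc : HasCompactSupport χ)
    (h0 : χ 0 = 1) {f : ℝ → ℝ} (hf : Integrable f) :
    Tendsto (fun R : ℝ => ∫ x, f x * χ (x / R)) atTop (𝓝 (∫ x, f x)) := by
  obtain ⟨C, hC⟩ := hχ.bounded_above_of_compact_support hc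
  refine tendsto_integral_filter_of_dominated_convergence (fun x => ‖f x‖ * C) ?_ ?_
    (hf.norm.mul_const C) ?_
  · exact Eventually.of_forall fun R =>
      hf.1.mul (hχ.comp (continuous_id.div_const R)).aestronglyMeasurable
  · refine Eventually.of_forall fun R => ae_of_all _ fun x => ?_
    rw [norm_mul]
    exact mul_le_mul_of_nonneg_left (hC _) (norm_nonneg _)
  · refine ae_of_all _ fun x => ?_
    have h1 : Tendsto (fun R : ℝ => χ (x / R)) atTop (𝓝 (χ 0)) :=
      (hχ.tendsto 0).comp (tendsto_const_nhds.div_atTop tendsto_id)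
    simpa [h0] using h1.const_mul (f x)

/-- The excess lies in L², so pairing it with a weight in L² converges without any L¹ hypothesis on
f. -/
theorem integrable_mass_mul {q : ℝ} {f w w₁ : ℝ → ℂ} (h : HasH1Deriv w w₁)
    (hf : f =ᵐ[volume] fun x => w x + q) {η : ℝ → ℝ} (hη : MemLp (fun x => (η x : ℂ)) 2) :
    Integrable (fun x => (‖f x‖ ^ 2 - q ^ 2) * η x) ∧
      ∫ x, (‖f x‖ ^ 2 - q ^ 2) * η x = (∫ x, excess q (w x) * η x).re := by
  have hi := integrable_mul_of_memLp_two (h.excess q).memLp hη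
  have e : ∀ x, excess q (w x) * η x = (((‖w x + q‖ ^ 2 - q ^ 2) * η x : ℝ) : ℂ) := fun x => by
    rw [excess_eq_ofReal, ← Complex.ofReal_mul]
  simp only [e] at hi ⊢
  have c : (fun x => (‖f x‖ ^ 2 - q ^ 2) * η x) =ᵐ[volume]
      fun x => (‖w x + q‖ ^ 2 - q ^ 2) * η x := by
    filter_upwards [hf] with x hx
    rw [hx]
  have hr : Integrable (fun x => (‖w x + q‖ ^ 2 - q ^ 2) * η x) := by
    simpa only [RCLike.re_to_complex, Complex.ofReal_re] using hi.re
  refine ⟨hr.congr c.symm, ?_⟩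
  rw [integral_congr_ae c, integral_complex_ofReal, Complex.ofReal_re]

theorem eq_of_hasDerivAt_zero {J : Set ℝ} (hJ : J.OrdConnected) {Φ : ℝ → ℝ}
    (h : ∀ t ∈ J, HasDerivAt Φ 0 t) {s t : ℝ} (hs : s ∈ J) (ht : t ∈ J) : Φ t = Φ s := by
  have := hJ.convex.norm_image_sub_le_of_norm_hasDerivWithin_le (C := 0)
    (fun x hx => (h x hx).hasDerivWithinAt) (fun x _ => by simp) hs ht
  rw [zero_mul] at this
  exact sub_eq_zero.1 (norm_le_zero_iff.1 this)

/-- The truncated masses at two times differ by a quantity that vanishes as the cutoff is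
removed. -/
theorem tendsto_mass_sub {q : ℝ} {a a₁ a₂ : ℝ → ℝ → ℂ} {J : Set ℝ} (hJ : J.OrdConnected)
    (h : ∀ t ∈ J, SolvesAt q a a₁ a₂ t) {χ : ℝ → ℝ} (hχ : ContDiff ℝ 1 χ)
    (hc : HasCompactSupport χ) {s t : ℝ} (hs : s ∈ J) (ht : t ∈ J) :
    Tendsto (fun R : ℝ => (∫ x, excess q (a t x) * (χ (x / R) : ℝ)).re -
      (∫ x, excess q (a s x) * (χ (x / R) : ℝ)).re) atTop (𝓝 0) := by
  have hsub : Set.uIcc s t ⊆ J := hJ.uIcc_subset hs ht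
  have hcont : ContinuousOn (fun r => (eLpNorm (fun x =>
      2 * Complex.I * current q (a r x) (a₁ r x) - 1 / 2 * quartic q (a r x)) 2
        volume).toReal) (Set.uIcc s t) := fun r hr =>
    ((h r (hsub hr)).massFlux q).tendsto_eLpNorm.mono_left nhdsWithin_le_nhds
  -- The L² norm of the flux is continuous in time, hence bounded between s and t; the mean value
  -- inequality then bounds the change of mass by ‖∂χ_R‖₂ B |t - s|.
  obtain ⟨B, hB⟩ := isCompact_uIcc.exists_bound_of_continuousOn hcont
  have hlim := ((tendsto_eLpNorm_deriv_cutoff hχ hc).mul_const B).mul_const ‖t - s‖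
  rw [zero_mul, zero_mul] at hlim
  refine squeeze_zero_norm' ?_ hlim
  filter_upwards [eventually_gt_atTop 0] with R hR
  have hη := hasH1Deriv_cutoff hχ hc hR
  refine (convex_uIcc s t).norm_image_sub_le_of_norm_hasDerivWithin_le
    (fun r hr => ((h r (hsub hr)).hasDerivAt_mass hη).hasDerivWithinAt) (fun r hr => ?_)
    Set.left_mem_uIcc Set.right_mem_uIcc
  rw [Complex.neg_re, norm_neg, Real.norm_eq_abs]
  refine (abs_re_integral_mul_le hη.memLp_deriv
    ((h r (hsub hr)).massFlux q).memLp_lim).trans ?_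
  exact mul_le_mul_of_nonneg_left ((Real.le_norm_self _).trans (hB r hr)) ENNReal.toReal_nonneg

end DNLS

end

/-! ### The conservation laws. -/

theorem theorem4 (χ : ℝ → ℝ) (hχ : ContDiff ℝ 1 χ)
    (hχ_supp : tsupport χ ⊆ Set.Icc (-2) 2) (hχ_one : ∀ x ∈ Set.Icc (-1 : ℝ) 1, χ x = 1)
    (q₀ : ℝ) (u₀ : ℝ → ℂ)
    (hu₀ : DNLS.MemH2 (fun x => u₀ x - (q₀ : ℂ)))
    (hu₀_int : Integrable (fun x => ‖u₀ x‖ ^ 2 - q₀ ^ 2))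
    (J : Set ℝ) (u : ℝ → ℝ → ℂ) (hu : DNLS.IsSolution q₀ u₀ J u) :
    (∃ m : ℝ, DNLS.HasMass q₀ χ u₀ m ∧ ∀ t ∈ J, DNLS.HasMass q₀ χ (u t) m) ∧
    (∃ e : ℝ, DNLS.HasEnergy q₀ u₀ e ∧ ∀ t ∈ J, DNLS.HasEnergy q₀ (u t) e) ∧
    (∃ p : ℝ, DNLS.HasMomentum q₀ u₀ p ∧ ∀ t ∈ J, DNLS.HasMomentum q₀ (u t) p) := by
  obtain ⟨a, a₁, a₂, ha⟩ := hu.exists_solvesAt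
  have hJ := hu.ordConnected
  have h0 := hu.zero_mem
  have hS := fun t ht => (ha t ht).1
  have hu0 := hu.initial.symm.trans (ha 0 h0).2
  have d0 := (ha 0 h0).1.deriv 0
  refine ⟨?_, ?_, ?_⟩
  · have hc : HasCompactSupport χ := isCompact_Icc.of_isClosed_subset (isClosed_tsupport χ) hχ_supp
    have hR : ∀ R : ℝ, 0 < R → MemLp (fun x => (χ (x / R) : ℂ)) 2 := fun R hR =>
      (DNLS.hasH1Deriv_cutoff hχ hc hR).memLp
    have hlim := DNLS.tendsto_integral_mul_cutoff hχ.continuous hc (hχ_one 0 (by simp)) hu₀_int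
    -- The common mass is ∫ (|u₀|² - q₀²), the limit at time 0 by dominated convergence; other times
    -- follow by adding the vanishing difference.
    refine ⟨_, ⟨fun R h => (DNLS.integrable_mass_mul d0 hu0 (hR R h)).1, hlim⟩, fun t ht =>
      ⟨fun R h => (DNLS.integrable_mass_mul ((ha t ht).1.deriv t) (ha t ht).2 (hR R h)).1, ?_⟩⟩
    have hd := hlim.add (DNLS.tendsto_mass_sub hJ hS hχ hc h0 ht)
    rw [add_zero] at hd
    refine hd.congr' ?_
    filter_upwards [eventually_gt_atTop 0] with R h
    rw [(DNLS.integrable_mass_mul d0 hu0 (hR R h)).2,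
      (DNLS.integrable_mass_mul ((ha t ht).1.deriv t) (ha t ht).2 (hR R h)).2]
    ring
  · refine ⟨_, DNLS.hasEnergy_of_hasH1Deriv d0 hu0, fun t ht => ?_⟩
    have e := DNLS.eq_of_hasDerivAt_zero hJ (fun r hr => (hS r hr).hasDerivAt_energy) h0 ht
    rw [← e]
    exact DNLS.hasEnergy_of_hasH1Deriv ((ha t ht).1.deriv t) (ha t ht).2
  · refine ⟨_, DNLS.hasMomentum_of_hasH1Deriv d0 hu0, fun t ht => ?_⟩
    have e := DNLS.eq_of_hasDerivAt_zero hJ (fun r hr => (hS r hr).hasDerivAt_momentum) h0 ht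
    rw [← e]
    exact DNLS.hasMomentum_of_hasH1Deriv ((ha t ht).1.deriv t) (ha t ht).2
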